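/- Two queues $Q_1,Q_2$ with infinite buffers operate in discrete time. Let $0<\lambda<\mu\le 1$. The initial lengths $X_0^i\sim\pi_0^i$, the arrival indicators $A_t^i\sim\mathrm{Bernoulli}(\lambda)$ and the service indicators $D_t^i\sim\mathrm{Bernoulli}(\mu)$ ($i=1,2$, $t=0,1,\dots$) are mutually independent, and for $j\ne i$ $$\overline X_t^i=(X_t^i-D_t^i)^++A_t^i,\qquad X_{t+1}^i=\overline X_t^i-U_t^i+U_t^j ,$$ where $U_t^i\in\{0,1\}$ is the routing decision of controller $i$, with $U_t^i=0$ whenever $\overline X_t^i=0$. A decentralized policy is a family $g=(g_t^i)$ of functions with $U_t^i=g_t^i\big(X_{0:t}^i,A_{0:t}^i,\overline X_{0:t}^i,U_{0:t-1}^1,U_{0:t-1}^2,\pi_0^1,\pi_0^2\big)$ that satisfies this constraint; $\mathcal G_d$ is the set of such policies. Let $c:\mathbb Z_{\ge0}\to\mathbb R$ be convex and increasing and put $$J_T^g=\mathbf E\Big[\sum_{t=0}^{T-1}\big(c(X_t^{1,g})+c(X_t^{2,g})\big)\Big],\qquad J^g=\limsup_{T\to\infty}\tfrac1T J_T^g .$$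 Let $\hat g$ be the policy under which, for $i=1,2$ and all $t$, $U_t^i=1$ if and only if $\overline X_t^i\ge TH_t$, where $TH_t$ is the midpoint of the largest and the smallest point of the union of the supports of the conditional laws under $\hat g$ of $\overline X_t^1$ and of $\overline X_t^2$ given $(U_{0:t-1}^1,U_{0:t-1}^2)$ (recursively in $t$; after past decisions of probability zero, $\hat g$ does not route). Theorem. Suppose that $\pi_0^1,\pi_0^2$ are finitely supported (and not necessarily equal), and that for the policy $g_0$ that never routes the limit $\lim_{T\to\infty}\frac1T J_T^{g_0}$ exists and is finite. Then $\hat g$ is optimal for the infinite horizon average cost per unit time problem: $\hat g\in\mathcal G_d$ and $J^{\hat g}\le J^{g}$ for every $g\in\mathcal G_d$. -/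

import Mathlib

open MeasureTheory ProbabilityTheory Filter Topology
open scoped ENNReal unitInterval

noncomputable section

namespace Routing

/-! ### Primitive random variables

The two stations are indexed by `Fin 2`; the station other than `i` is `1 - i`. -/

/-- An outcome: the initial queue lengths `X_0^i`, and for each time `t` and station `i` the pair
`(A_t^i, D_t^i)` of exogenous arrival and (potential) service completion. -/
abbrev Outcome : Type := (Fin 2 → ℕ) × (ℕ → Fin 2 → Bool × Bool)

/-- The arrival indicator `A_t^i`. -/
def arrival (ω : Outcome) (t : ℕ) (i : Fin 2) : Bool := (ω.2 t i).1

/-- The service indicator `D_t^i`. -/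
def service (ω : Outcome) (t : ℕ) (i : Fin 2) : Bool := (ω.2 t i).2

/-- The law of the primitive random variables: `X_0^i ∼ π i`, `A_t^i ∼ Bernoulli(lam)`,
`D_t^i ∼ Bernoulli(mu)`, all of them mutually independent. -/
def law (lam mu : I) (π : Fin 2 → PMF ℕ) : Measure Outcome :=
  (Measure.pi fun i => (π i).toMeasure).prod
    (Measure.infinitePi fun _ : ℕ => Measure.pi fun _ : Fin 2 =>
      (bernoulliMeasure true false lam).prod (bernoulliMeasure true false mu))

/-! ### Dynamics -/

/-- The queue lengths after service and exogenous arrival, before routing: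
`(x^i - D_t^i)^+ + A_t^i`. -/
def afterService (ω : Outcome) (t : ℕ) (x : Fin 2 → ℕ) (i : Fin 2) : ℕ :=
  (x i - (service ω t i).toNat) + (arrival ω t i).toNat

/-- The queue lengths `X_t^i` produced by a sequence `u` of routing decisions
(`u t i = true` means that station `i` sends one customer to the other station at time `t`);
`X_t` depends only on `u 0, …, u (t-1)`. -/
def queue (ω : Outcome) (u : ℕ → Fin 2 → Bool) : ℕ → Fin 2 → ℕ
  | 0 => ω.1
  | t + 1 => fun i =>
      afterService ω t (queue ω u t) i - (u t i).toNat + (u t (1 - i)).toNat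

/-- The queue lengths `X̄_t^i` at the moment of the routing decision. -/
def queueBar (ω : Outcome) (u : ℕ → Fin 2 → Bool) (t : ℕ) : Fin 2 → ℕ :=
  afterService ω t (queue ω u t)

/-! ### Decentralized policies -/

/-- The data available to one controller when it decides at time `t`. -/
structure Info (t : ℕ) where
  /-- own queue lengths `X^i_{0:t}` -/
  x : Fin (t + 1) → ℕ
  /-- own exogenous arrivals `A^i_{0:t}` -/
  a : Fin (t + 1) → Bool
  /-- own queue lengths before routing `X̄^i_{0:t}` -/
  xbar : Fin (t + 1) → ℕ
  /-- the past decisions `U^1_{0:t-1}, U^2_{0:t-1}` of both controllers -/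
  u : Fin t → Fin 2 → Bool

/-- A decentralized policy: controller `i` decides at time `t` from its own information. -/
abbrev Policy : Type := Fin 2 → (t : ℕ) → Info t → Bool

/-- A controller cannot route a customer out of an empty queue. -/
def Feasible (g : Policy) : Prop :=
  ∀ i t (h : Info t), h.xbar (Fin.last t) = 0 → g i t h = false

/-- The information of controller `i` at time `t`, when the past decisions are given by `u`. -/
def info (ω : Outcome) (u : ℕ → Fin 2 → Bool) (i : Fin 2) (t : ℕ) : Info t where
  x s := queue ω u s i
  a s := arrival ω s i
  xbar s := queueBar ω u s i
  u s := u s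

/-- The decisions taken under policy `g` strictly before time `t` (and `false` from then on). -/
def past (g : Policy) (ω : Outcome) : ℕ → ℕ → Fin 2 → Bool
  | 0 => fun _ _ => false
  | t + 1 => Function.update (past g ω t) t fun i => g i t (info ω (past g ω t) i t)

/-- The routing decisions `U_t^i` under policy `g`. -/
def action (g : Policy) (ω : Outcome) (t : ℕ) (i : Fin 2) : Bool := past g ω (t + 1) t i

/-- The queue lengths `X_t^i` under policy `g`. -/
def X (g : Policy) (ω : Outcome) : ℕ → Fin 2 → ℕ := queue ω (action g ω)

/-- The queue lengths before routing `X̄_t^i` under policy `g`. -/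
def Xbar (g : Policy) (ω : Outcome) : ℕ → Fin 2 → ℕ := queueBar ω (action g ω)

theorem queue_congr (ω : Outcome) {u v : ℕ → Fin 2 → Bool} {t : ℕ}
    (h : ∀ s < t, u s = v s) : queue ω u t = queue ω v t := by
  induction t with
  | zero => rfl
  | succ t ih =>
    funext i
    simp only [queue, ih fun s hs => h s (by omega), h t (by omega)]

theorem info_congr (ω : Outcome) {u v : ℕ → Fin 2 → Bool} {t : ℕ}
    (h : ∀ s < t, u s = v s) (i : Fin 2) : info ω u i t = info ω v i t := by
  have hq : ∀ s : Fin (t + 1), queue ω u s = queue ω v s := fun s =>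
    queue_congr ω fun r hr => h r (by omega)
  have hu : (fun s : Fin t => u s) = fun s : Fin t => v s := funext fun s => h s s.2
  simp only [info, queueBar, hq, hu]

theorem past_eq (g : Policy) (ω : Outcome) {s t : ℕ} (h : s < t) :
    past g ω t s = action g ω s := by
  induction t with
  | zero => omega
  | succ t ih =>
    rcases Nat.lt_succ_iff_lt_or_eq.1 h with h' | rfl
    · rw [past, Function.update_of_ne (by omega), ih h']
    · rfl

/-- Decisions are generated from the information by the policy: `U_t^i = g_t^i(I_t^i)`. -/
theorem action_eq (g : Policy) (ω : Outcome) (t : ℕ) (i : Fin 2) :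
    action g ω t i = g i t (info ω (action g ω) i t) := by
  rw [← info_congr ω (fun s hs => past_eq g ω hs) i]
  simp [action, past]

/-! ### Cost -/

/-- The expected holding cost over the horizon `T`. When the initial distributions have finite
support the queue lengths at each time are almost surely bounded, so this is a genuine
expectation. -/
def horizonCost (lam mu : I) (c : ℕ → ℝ) (π : Fin 2 → PMF ℕ) (g : Policy) (T : ℕ) : ℝ :=
  ∫ ω, ∑ t ∈ Finset.range T, (c (X g ω t 0) + c (X g ω t 1)) ∂law lam mu π

/-- The infinite horizon average cost per unit time (possibly `+∞`). -/
def averageCost (lam mu : I) (c : ℕ → ℝ) (π : Fin 2 → PMF ℕ) (g : Policy) : EReal :=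
  limsup (fun T : ℕ => ((horizonCost lam mu c π g T / T : ℝ) : EReal)) atTop

/-- The policy that never routes a customer. -/
def noRouting : Policy := fun _ _ _ => false

/-! ### The threshold policy -/

/-- The event that the decisions before time `t` under `g` are `u`. -/
def pastEvent (g : Policy) (t : ℕ) (u : Fin t → Fin 2 → Bool) : Set Outcome :=
  {ω | (fun s : Fin t => action g ω s) = u}

/-- The conditional probability mass function `Π̄_t^i` of `X̄_t^i` given that the past decisions
are `u`. -/
def condPMF (lam mu : I) (π : Fin 2 → PMF ℕ) (g : Policy) (i : Fin 2) (t : ℕ)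
    (u : Fin t → Fin 2 → Bool) (x : ℕ) : ℝ≥0∞ :=
  (law lam mu π)[{ω | Xbar g ω t i = x} | pastEvent g t u]

/-- The largest point of the support of `Π̄_t^i`. -/
def upper (lam mu : I) (π : Fin 2 → PMF ℕ) (g : Policy) (i : Fin 2) (t : ℕ)
    (u : Fin t → Fin 2 → Bool) : ℕ :=
  sSup {x | condPMF lam mu π g i t u x ≠ 0}

/-- The smallest point of the support of `Π̄_t^i`. -/
def lower (lam mu : I) (π : Fin 2 → PMF ℕ) (g : Policy) (i : Fin 2) (t : ℕ)
    (u : Fin t → Fin 2 → Bool) : ℕ :=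
  sInf {x | condPMF lam mu π g i t u x ≠ 0}

/-- The threshold `TH_t`: the midpoint of the largest and the smallest point of the supports of
`Π̄_t^1` and `Π̄_t^2`, given that the past decisions are `u`. -/
def threshold (lam mu : I) (π : Fin 2 → PMF ℕ) (g : Policy) (t : ℕ)
    (u : Fin t → Fin 2 → Bool) : ℝ :=
  ((max (upper lam mu π g 0 t u) (upper lam mu π g 1 t u) : ℕ) +
    (min (lower lam mu π g 0 t u) (lower lam mu π g 1 t u) : ℕ)) / 2

open scoped Classical in
/-- The rule "route iff `X̄_t^i ≥ TH_t`", where `TH_t` is computed as if the decisions before time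
`t` had been generated by `g`. After past decisions of probability zero, where the conditional
distributions do not exist, no customer is routed. -/
def thresholdRule (lam mu : I) (π : Fin 2 → PMF ℕ) (g : Policy) : Policy := fun _ t h =>
  decide (law lam mu π (pastEvent g t h.u) ≠ 0 ∧
    threshold lam mu π g t h.u ≤ (h.xbar (Fin.last t) : ℝ))

/-- The policy `ĝ`. The time-`t` part of `thresholdRule g` depends only on the parts of `g` before
time `t`, so the iteration determines the decision rules one time step after another; `ĝ` is the
policy that follows the threshold rule computed from `ĝ` itself (`gHat_eq`). -/
def gHat (lam mu : I) (π : Fin 2 → PMF ℕ) : Policy := fun i t h =>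
  ((thresholdRule lam mu π)^[t + 1] noRouting) i t h

theorem past_congr {g g' : Policy} {t : ℕ} (h : ∀ s < t, ∀ i, g i s = g' i s) (ω : Outcome) :
    past g ω t = past g' ω t := by
  induction t with
  | zero => rfl
  | succ t ih =>
    have h1 := ih fun s hs => h s (by omega)
    simp only [past, h1, h t (by omega)]

theorem action_congr {g g' : Policy} {t : ℕ} (h : ∀ s < t, ∀ i, g i s = g' i s) (ω : Outcome)
    {s : ℕ} (hs : s < t) : action g ω s = action g' ω s := by
  rw [← past_eq g ω hs, ← past_eq g' ω hs, past_congr h]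

theorem thresholdRule_congr (lam mu : I) (π : Fin 2 → PMF ℕ) {g g' : Policy} {t : ℕ}
    (h : ∀ s < t, ∀ i, g i s = g' i s) (i : Fin 2) :
    thresholdRule lam mu π g i t = thresholdRule lam mu π g' i t := by
  have hE : ∀ u, pastEvent g t u = pastEvent g' t u := by
    intro u
    have : ∀ ω, (fun s : Fin t => action g ω s) = fun s : Fin t => action g' ω s :=
      fun ω => funext fun s => action_congr h ω s.2
    simp only [pastEvent, this]
  have hX : ∀ ω, Xbar g ω t = Xbar g' ω t := by
    intro ω
    simp only [Xbar, queueBar, queue_congr ω fun s hs => action_congr h ω hs]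
  funext k
  simp only [thresholdRule, threshold, upper, lower, condPMF, hE, hX]
  exact decide_eq_decide.2 Iff.rfl

/-- `ĝ` is the policy that routes iff `X̄_t^i ≥ TH_t`, with `TH_t` computed under `ĝ`. -/
theorem gHat_eq (lam mu : I) (π : Fin 2 → PMF ℕ) :
    gHat lam mu π = thresholdRule lam mu π (gHat lam mu π) := by
  have key : ∀ t n, t < n → ∀ i,
      ((thresholdRule lam mu π)^[n] noRouting) i t = gHat lam mu π i t := by
    intro t
    induction t using Nat.strong_induction_on with
    | _ t ih =>
      intro n hn i
      obtain ⟨m, rfl⟩ : ∃ m, n = m + 1 := ⟨n - 1, by omega⟩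
      funext k
      simp only [gHat, Function.iterate_succ_apply']
      rw [thresholdRule_congr lam mu π
        (g' := (thresholdRule lam mu π)^[t] noRouting) (t := t) _ i]
      intro s hs j
      rw [ih s hs m (by omega) j, ih s hs t hs j]
  funext i t k
  simp only [gHat, Function.iterate_succ_apply']
  rw [thresholdRule_congr lam mu π (t := t) _ i]
  intro s hs j
  exact key s t hs j

end Routing

end

noncomputable section

namespace Routing

/-! ### One step of the total queue length -/

/-! Every policy is compared with a fictitious balanced system, the Markov chain on total queue
lengths with operator `balancedOp`, in which the customers are split evenly before each step.
Routing preserves the total (`totalX_succ`), and balancing keeps as many stations busy as possible,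
so the total under any feasible policy stochastically dominates the balanced chain started empty. By
convexity of `c` a given total costs least when split evenly. Hence the cost at time `t` of every
policy is at least the `t`-th iterate of `balancedCost c` at `0` (`iterate_le_stageCost`). These
iterates increase with `t`. If they diverge, every policy has average cost `⊤`; otherwise let `L` be
their limit, so that every average cost is at least `L`.

It remains to bound the stage costs of the threshold policy asymptotically by `L`. The decisions are
public, so each one reveals on which side of the midpoint both queues lie. Thus the width of the
common support never grows beyond its starting size or `3`, and a width of at most `3` persists and
forces the queues to differ by at most one from the next step on (`Regular.spread_succ`). A Lyapunov
argument shows that the width is eventually at most `3` with probability tending to one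
(`tendsto_wideProb`). From then on the total is exactly the balanced chain, which forgets its
initial state on emptying (`iterate_le_survival`).

Since `c` may be unbounded, the cost is cut at a level `N`. The part above `N` is controlled through
domination by a shifted balanced chain (`integral_sub_le_iterate`) and a uniform tail estimate
(`tail_uniformly_small`). -/

/-- The arrival and service indicators of both stations in one time step. -/
abbrev Step : Type := Fin 2 → Bool × Bool

/-- The law of the arrivals and services in one time step. -/
def stepLaw (lam mu : I) : Measure Step :=
  Measure.pi fun _ : Fin 2 =>
    (bernoulliMeasure true false lam).prod (bernoulliMeasure true false mu)

instance (lam mu : I) : IsProbabilityMeasure (stepLaw lam mu) := by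
  unfold stepLaw; infer_instance

theorem integrable_stepLaw (lam mu : I) (f : Step → ℝ) : Integrable f (stepLaw lam mu) :=
  Integrable.of_finite

/-- The total queue length after service and arrivals, starting from the queue lengths `x`. -/
def total (x : Fin 2 → ℕ) (w : Step) : ℕ :=
  ((x 0 - (w 0).2.toNat) + (w 0).1.toNat) + ((x 1 - (w 1).2.toNat) + (w 1).1.toNat)

/-- The balanced configuration of `s` customers. -/
def balanced (s : ℕ) : Fin 2 → ℕ := ![(s + 1) / 2, s / 2]

/-- The expectation of `f` at the total queue length one step after the queue lengths `x`. -/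
def stepMean (lam mu : I) (f : ℕ → ℝ) (x : Fin 2 → ℕ) : ℝ :=
  ∫ w, f (total x w) ∂stepLaw lam mu

/-- The transition operator of the total queue length of a balanced system. -/
def balancedOp (lam mu : I) (f : ℕ → ℝ) (s : ℕ) : ℝ := stepMean lam mu f (balanced s)

theorem stepMean_mono {lam mu : I} {f g : ℕ → ℝ} {x y : Fin 2 → ℕ}
    (h : ∀ w, f (total x w) ≤ g (total y w)) : stepMean lam mu f x ≤ stepMean lam mu g y :=
  integral_mono (integrable_stepLaw _ _ _) (integrable_stepLaw _ _ _) h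

theorem stepMean_const (lam mu : I) (a : ℝ) (x : Fin 2 → ℕ) :
    stepMean lam mu (fun _ => a) x = a := by
  simp [stepMean]

theorem stepMean_add (lam mu : I) (f g : ℕ → ℝ) (x : Fin 2 → ℕ) :
    stepMean lam mu (fun s => f s + g s) x = stepMean lam mu f x + stepMean lam mu g x :=
  integral_add (integrable_stepLaw _ _ _) (integrable_stepLaw _ _ _)

theorem stepMean_const_mul (lam mu : I) (a : ℝ) (f : ℕ → ℝ) (x : Fin 2 → ℕ) :
    stepMean lam mu (fun s => a * f s) x = a * stepMean lam mu f x :=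
  integral_const_mul _ _

theorem balancedOp_add (lam mu : I) (f g : ℕ → ℝ) :
    balancedOp lam mu (fun s => f s + g s) =
      fun s => balancedOp lam mu f s + balancedOp lam mu g s :=
  funext fun _ => stepMean_add _ _ _ _ _

/-- Station `0` holds the odd customer, so it is busy from one customer on and station `1` from two
on. -/
theorem total_balanced (s : ℕ) (w : Step) :
    total (balanced s) w = s - (if 1 ≤ s then (w 0).2.toNat else 0)
      - (if 2 ≤ s then (w 1).2.toNat else 0) + (w 0).1.toNat + (w 1).1.toNat := by
  simp only [total, balanced, Matrix.cons_val_zero, Matrix.cons_val_one]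
  have h0 := Bool.toNat_le (w 0).2
  have h1 := Bool.toNat_le (w 1).2
  split_ifs <;> omega

/-- Pathwise coupling: one more customer makes at most one more station busy. -/
theorem total_balanced_mono {s t : ℕ} (h : s ≤ t) (w : Step) :
    total (balanced s) w ≤ total (balanced t) w := by
  rw [total_balanced, total_balanced]
  have h0 := Bool.toNat_le (w 0).2
  have h1 := Bool.toNat_le (w 1).2
  split_ifs <;> omega

theorem balancedOp_monotone {lam mu : I} {f : ℕ → ℝ} (hf : Monotone f) :
    Monotone (balancedOp lam mu f) := fun _ _ h =>
  stepMean_mono fun w => hf (total_balanced_mono h w)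

theorem balancedOp_le {lam mu : I} {f g : ℕ → ℝ} (h : ∀ s, f s ≤ g s) (s : ℕ) :
    balancedOp lam mu f s ≤ balancedOp lam mu g s := stepMean_mono fun _ => h _

theorem iterate_monotone {lam mu : I} {f : ℕ → ℝ} (hf : Monotone f) (n : ℕ) :
    Monotone ((balancedOp lam mu)^[n] f) := by
  induction n with
  | zero => exact hf
  | succ n ih => rw [Function.iterate_succ_apply']; exact balancedOp_monotone ih

theorem iterate_le {lam mu : I} {f g : ℕ → ℝ} (h : ∀ s, f s ≤ g s) (n s : ℕ) :
    (balancedOp lam mu)^[n] f s ≤ (balancedOp lam mu)^[n] g s := by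
  induction n generalizing s with
  | zero => exact h s
  | succ n ih => simp only [Function.iterate_succ_apply']; exact balancedOp_le ih s

theorem iterate_add (lam mu : I) (f g : ℕ → ℝ) (n : ℕ) :
    (balancedOp lam mu)^[n] (fun s => f s + g s) =
      fun s => (balancedOp lam mu)^[n] f s + (balancedOp lam mu)^[n] g s := by
  induction n with
  | zero => rfl
  | succ n ih => simp only [Function.iterate_succ_apply', ih]; exact balancedOp_add _ _ _ _

/-! ### Exchangeability of the stations and optimality of balancing -/

theorem total_swap (w : Step) : total ![0, 1] w = total ![1, 0] (w ∘ Equiv.swap 0 1) := by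
  simp [total]; omega

theorem measurePreserving_swap (lam mu : I) :
    MeasurePreserving (fun w : Step => w ∘ Equiv.swap (0 : Fin 2) 1)
      (stepLaw lam mu) (stepLaw lam mu) := by
  have := measurePreserving_piCongrLeft (fun _ : Fin 2 =>
    (bernoulliMeasure true false lam).prod (bernoulliMeasure true false mu)) (Equiv.swap 0 1)
  have e : (MeasurableEquiv.piCongrLeft (fun _ : Fin 2 => Bool × Bool) (Equiv.swap 0 1) :
      Step → Step) = fun w => w ∘ Equiv.swap (0 : Fin 2) 1 := by
    funext w i
    fin_cases i <;> rfl
  rwa [e] at this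

theorem stepMean_swap (lam mu : I) (f : ℕ → ℝ) :
    stepMean lam mu f ![0, 1] = stepMean lam mu f ![1, 0] := by
  simp only [stepMean, total_swap]
  have h := measurePreserving_swap lam mu
  conv_rhs => rw [← h.map_eq]
  rw [integral_map h.aemeasurable Measurable.of_discrete.aestronglyMeasurable]

/-- This is the one configuration that cannot be compared pathwise with the balanced one `(1, 0)`:
the busy stations differ, and only the laws agree, by symmetry. -/
theorem stepMean_zero_one (lam mu : I) (f : ℕ → ℝ) {x : Fin 2 → ℕ} (h0 : x 0 = 0) (h1 : x 1 = 1) :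
    stepMean lam mu f x = balancedOp lam mu f (x 0 + x 1) := by
  have hx : x = ![0, 1] := by ext i; fin_cases i <;> simp [h0, h1]
  rw [hx, stepMean_swap]; rfl

/-- Balancing the queues minimizes the total queue length after the next step. -/
theorem balancedOp_le_stepMean {lam mu : I} {f : ℕ → ℝ} (hf : Monotone f) (x : Fin 2 → ℕ) :
    balancedOp lam mu f (x 0 + x 1) ≤ stepMean lam mu f x := by
  by_cases h : x 0 = 0 ∧ x 1 = 1
  · rw [stepMean_zero_one _ _ _ h.1 h.2]
  -- Every station busy in `x` is also busy in the balanced configuration, so the comparison is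
  -- pathwise.
  · refine stepMean_mono fun w => hf ?_
    rw [total_balanced, total]
    have h0 := Bool.toNat_le (w 0).2
    have h1 := Bool.toNat_le (w 1).2
    split_ifs <;> omega

theorem stepMean_eq_balancedOp {lam mu : I} (f : ℕ → ℝ) {x : Fin 2 → ℕ}
    (h0 : x 0 ≤ x 1 + 1) (h1 : x 1 ≤ x 0 + 1) :
    stepMean lam mu f x = balancedOp lam mu f (x 0 + x 1) := by
  by_cases h : x 0 = 0 ∧ x 1 = 1
  · rw [stepMean_zero_one _ _ _ h.1 h.2]
  · refine integral_congr_ae (ae_of_all _ fun w => congrArg f ?_)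
    rw [total_balanced, total]
    have h0 := Bool.toNat_le (w 0).2
    have h1 := Bool.toNat_le (w 1).2
    split_ifs <;> omega

/-- Above the level `C` both stations are busy, so the excess over `C` is dominated by the
balanced system. -/
theorem stepMean_sub_le {lam mu : I} {f : ℕ → ℝ} (hf : Monotone f) {C : ℕ} {x : Fin 2 → ℕ}
    (h : C ≤ x 0 + x 1 → 1 ≤ x 0 ∧ 1 ≤ x 1) :
    stepMean lam mu (fun s => f (s - C)) x ≤ balancedOp lam mu f (x 0 + x 1 - C) := by
  refine stepMean_mono fun w => hf ?_
  rw [total_balanced, total]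
  have h0 := Bool.toNat_le (w 0).2
  have h1 := Bool.toNat_le (w 1).2
  by_cases hC : C ≤ x 0 + x 1
  · obtain ⟨h2, h3⟩ := h hC
    split_ifs <;> omega
  · split_ifs <;> omega

/-- After one extra step the chain is at some state above `0`, and the remaining steps are monotone
in the state. -/
theorem iterate_zero_monotone {lam mu : I} {f : ℕ → ℝ} (hf : Monotone f) :
    Monotone fun n => (balancedOp lam mu)^[n] f 0 := by
  refine monotone_nat_of_le_succ fun n => ?_
  rw [Function.iterate_succ_apply']
  calc (balancedOp lam mu)^[n] f 0
      = stepMean lam mu (fun _ => (balancedOp lam mu)^[n] f 0) (balanced 0) :=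
        (stepMean_const ..).symm
    _ ≤ _ := stepMean_mono fun w => iterate_monotone hf n (Nat.zero_le _)

/-! ### Probabilities of single steps -/

theorem bernoulli_real_true (p : I) : (bernoulliMeasure true false p).real {true} = p := by
  rw [bernoulliMeasure_real_apply_of_mem_of_notMem] <;> simp

theorem bernoulli_real_false (p : I) : (bernoulliMeasure true false p).real {false} = 1 - p := by
  rw [bernoulliMeasure_real_apply_of_notMem_of_mem] <;> simp

theorem stepLaw_real_singleton (lam mu : I) (w : Step) :
    (stepLaw lam mu).real {w} = ∏ i, (bernoulliMeasure true false lam).real {(w i).1} *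
      (bernoulliMeasure true false mu).real {(w i).2} := by
  rw [stepLaw, measureReal_def, Measure.pi_singleton, ENNReal.toReal_prod]
  refine Finset.prod_congr rfl fun i _ => ?_
  rw [← measureReal_def, ← measureReal_prod_prod, Set.singleton_prod_singleton]

/-- Both stations serve and nobody arrives. -/
def drain : Step := fun _ => (false, true)

/-- Nobody is served and there are arrivals at both stations. -/
def fill : Step := fun _ => (true, false)

theorem drain_pos {lam mu : I} (hlam : (lam : ℝ) < 1) (hmu : 0 < (mu : ℝ)) :
    0 < (stepLaw lam mu).real {drain} := by
  rw [stepLaw_real_singleton]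
  refine Finset.prod_pos fun i _ => ?_
  simp only [drain, bernoulli_real_true, bernoulli_real_false]
  exact mul_pos (by linarith) hmu

theorem fill_pos {lam mu : I} (hlam : 0 < (lam : ℝ)) (hmu : (mu : ℝ) < 1) :
    0 < (stepLaw lam mu).real {fill} := by
  rw [stepLaw_real_singleton]
  refine Finset.prod_pos fun i _ => ?_
  simp only [fill, bernoulli_real_true, bernoulli_real_false]
  exact mul_pos hlam (by linarith)

theorem integral_toNat (p : I) :
    ∫ b, (b.toNat : ℝ) ∂bernoulliMeasure true false p = p := by
  rw [integral_fintype Integrable.of_finite]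
  simp

theorem measurePreserving_step (lam mu : I) (i : Fin 2) :
    MeasurePreserving (fun w : Step => w i) (stepLaw lam mu)
      ((bernoulliMeasure true false lam).prod (bernoulliMeasure true false mu)) :=
  measurePreserving_eval _ i

theorem integral_arrival (lam mu : I) (i : Fin 2) :
    ∫ w, ((w i).1.toNat : ℝ) ∂stepLaw lam mu = lam := by
  have h : MeasurePreserving (fun w : Step => (w i).1) (stepLaw lam mu)
      (bernoulliMeasure true false lam) := measurePreserving_fst.comp (measurePreserving_step lam mu i)
  rw [← integral_toNat lam, ← h.map_eq, integral_map h.aemeasurable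
    Measurable.of_discrete.aestronglyMeasurable]

theorem integral_service (lam mu : I) (i : Fin 2) :
    ∫ w, ((w i).2.toNat : ℝ) ∂stepLaw lam mu = mu := by
  have h : MeasurePreserving (fun w : Step => (w i).2) (stepLaw lam mu)
      (bernoulliMeasure true false mu) := measurePreserving_snd.comp (measurePreserving_step lam mu i)
  rw [← integral_toNat mu, ← h.map_eq, integral_map h.aemeasurable
    Measurable.of_discrete.aestronglyMeasurable]

theorem ae_service_of_mu_eq_one (lam : I) {mu : I} (hmu : mu = 1) (i : Fin 2) :
    ∀ᵐ w ∂stepLaw lam mu, (w i).2 = true := by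
  have h : MeasurePreserving (fun w : Step => (w i).2) (stepLaw lam mu)
      (bernoulliMeasure true false mu) := measurePreserving_snd.comp (measurePreserving_step lam mu i)
  have h2 : ∀ᵐ b ∂bernoulliMeasure true false mu, b = true := by
    rw [hmu, bernoulliMeasure_one, ae_dirac_eq]
    rfl
  exact h.quasiMeasurePreserving.ae h2

/-! ### A Lyapunov function -/

/-- A strictly increasing function of slope one above `R`, and of geometrically growing slope
below `R`. -/
def lyap (γ : ℝ) (R s : ℕ) : ℝ := ∑ j ∈ Finset.range s, γ ^ (R - (j + 1))

theorem lyap_succ (γ : ℝ) (R s : ℕ) : lyap γ R (s + 1) = lyap γ R s + γ ^ (R - (s + 1)) :=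
  Finset.sum_range_succ _ _

theorem lyap_nonneg {γ : ℝ} (hγ : 1 ≤ γ) (R s : ℕ) : 0 ≤ lyap γ R s :=
  Finset.sum_nonneg fun _ _ => by positivity

theorem lyap_add_le {γ : ℝ} (hγ : 1 ≤ γ) (R s k : ℕ) :
    lyap γ R (s + k) ≤ lyap γ R s + k * γ ^ (R - (s + 1)) := by
  induction k with
  | zero => simp
  | succ k ih =>
    rw [← add_assoc, lyap_succ]
    have : γ ^ (R - (s + k + 1)) ≤ γ ^ (R - (s + 1)) := pow_le_pow_right₀ hγ (by omega)
    push_cast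
    linarith

theorem add_le_lyap {γ : ℝ} (hγ : 1 ≤ γ) (R s k : ℕ) : lyap γ R s + k ≤ lyap γ R (s + k) := by
  induction k with
  | zero => simp
  | succ k ih =>
    rw [← add_assoc, lyap_succ]
    have : 1 ≤ γ ^ (R - (s + k + 1)) := one_le_pow₀ hγ
    push_cast
    linarith

theorem lyap_mono {γ : ℝ} (hγ : 1 ≤ γ) (R : ℕ) : Monotone (lyap γ R) :=
  monotone_nat_of_le_succ fun s => by
    rw [lyap_succ]
    have : 0 ≤ γ ^ (R - (s + 1)) := by positivity
    linarith

/-- The slope parameter for which `lyap` has negative drift. -/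
def lyapBase (lam mu : I) : ℝ :=
  (2 + 2 * ((mu : ℝ) - lam)) / (stepLaw lam mu).real {drain}

theorem drain_pos_of_lt {lam mu : I} (hlam : (0 : ℝ) < lam) (hmu : (lam : ℝ) < mu) :
    0 < (stepLaw lam mu).real {drain} :=
  drain_pos (hmu.trans_le mu.2.2) (hlam.trans hmu)

theorem one_le_lyapBase {lam mu : I} (hlam : (0 : ℝ) < lam) (hmu : (lam : ℝ) < mu)
    : 1 ≤ lyapBase lam mu := by
  have hq := drain_pos_of_lt hlam hmu
  rw [lyapBase, le_div_iff₀ hq]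
  have : (stepLaw lam mu).real {drain} ≤ 1 := measureReal_le_one
  linarith

/-- The Lyapunov function decreases on average, as long as some customer is present and both
stations are busy above the level `R`. -/
theorem stepMean_lyap_le {lam mu : I} (hlam : (0 : ℝ) < lam) (hmu : (lam : ℝ) < mu)
    {R : ℕ} {x : Fin 2 → ℕ} (h1 : 1 ≤ x 0 + x 1)
    (hR : R ≤ x 0 + x 1 → 1 ≤ x 0 ∧ 1 ≤ x 1) :
    stepMean lam mu (lyap (lyapBase lam mu) R) x + 2 * ((mu : ℝ) - lam) ≤
      lyap (lyapBase lam mu) R (x 0 + x 1) := by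
  have hγ := one_le_lyapBase hlam hmu
  have hq := drain_pos_of_lt hlam hmu
  set γ := lyapBase lam mu with hγdef
  have hI := integrable_stepLaw lam mu
  by_cases h : R ≤ x 0 + x 1
  · obtain ⟨hx0, hx1⟩ := hR h
    -- Upward moves from a level above `R` have slope one and downward moves slope at least one, so
    -- the increment is at most arrivals minus services.
    have key : ∀ w, lyap γ R (total x w) ≤ lyap γ R (x 0 + x 1) +
        ((((w 0).1.toNat : ℝ) + (w 1).1.toNat) - ((w 0).2.toNat + (w 1).2.toNat)) := by
      intro w
      have h0 := Bool.toNat_le (w 0).2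
      have h1 := Bool.toNat_le (w 1).2
      have ht : total x w + (w 0).2.toNat + (w 1).2.toNat =
          x 0 + x 1 + (w 0).1.toNat + (w 1).1.toNat := by
        rw [total]; omega
      have htr : (total x w : ℝ) + (w 0).2.toNat + (w 1).2.toNat =
          (x 0 + x 1 : ℕ) + (w 0).1.toNat + (w 1).1.toNat := by exact_mod_cast ht
      rcases le_total (x 0 + x 1) (total x w) with hc | hc
      · obtain ⟨k, hk⟩ := Nat.exists_eq_add_of_le hc
        have := lyap_add_le hγ R (x 0 + x 1) k
        rw [hk] at htr ⊢
        rw [show R - (x 0 + x 1 + 1) = 0 by omega] at this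
        push_cast at htr this
        linarith
      · obtain ⟨k, hk⟩ := Nat.exists_eq_add_of_le hc
        have := add_le_lyap hγ R (total x w) k
        rw [hk] at htr ⊢
        push_cast at htr
        linarith
    have := integral_mono (hI _) (hI _) key
    rw [integral_add (hI _) (hI _), integral_sub (hI _) (hI _), integral_add (hI _) (hI _),
      integral_add (hI _) (hI _), integral_arrival, integral_arrival, integral_service,
      integral_service] at this
    simp only [integral_const, probReal_univ, smul_eq_mul] at this
    rw [stepMean]
    linarith
  · obtain ⟨s, hs⟩ : ∃ s, x 0 + x 1 = s + 1 := ⟨x 0 + x 1 - 1, by omega⟩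
    -- Below `R`: the slope just above the level `s + 1` is `γ ^ k` and just below it `γ ^ (k + 1)`.
    -- Two arrivals gain at most `2 * γ ^ k`, and `drain` loses at least `γ ^ (k + 1)`.
    obtain ⟨k, hk⟩ : ∃ k, R = s + 1 + k + 1 := ⟨R - (s + 2), by omega⟩
    have key : ∀ w, lyap γ R (total x w) ≤ (lyap γ R (s + 1) + 2 * γ ^ k) -
        Set.indicator {drain} (fun _ => γ ^ (k + 1)) w := by
      intro w
      have hk0 : 0 ≤ γ ^ k := by positivity
      by_cases hw : w = drain
      · subst hw
        have ht : total x drain ≤ s := by simp [total, drain]; omega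
        have h2 := lyap_mono hγ R ht
        rw [Set.indicator_of_mem (Set.mem_singleton _), lyap_succ, show R - (s + 1) = k + 1 by omega]
        linarith
      · rw [Set.indicator_of_notMem (by simpa using hw)]
        have ht : total x w ≤ s + 1 + 2 := by
          have h0 := Bool.toNat_le (w 0).1
          have h1 := Bool.toNat_le (w 1).1
          rw [total]; omega
        have h2 := lyap_mono hγ R ht
        have h3 := lyap_add_le hγ R (s + 1) 2
        rw [show R - (s + 1 + 1) = k by omega] at h3
        push_cast at h3
        linarith
    have := integral_mono (hI _) (hI _) key
    rw [integral_sub (hI _) (hI _), integral_indicator_const _ (by measurability)] at this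
    simp only [integral_const, probReal_univ, smul_eq_mul] at this
    -- The base is chosen so that the mean loss through `drain` covers the possible gain `2 * γ ^ k`
    -- and leaves the required drift.
    have h2 : (stepLaw lam mu).real {drain} * γ ^ (k + 1) = (2 + 2 * ((mu : ℝ) - lam)) * γ ^ k := by
      rw [pow_succ, hγdef, lyapBase]
      field_simp
    have h3 : 1 ≤ γ ^ k := one_le_pow₀ hγ
    rw [h2] at this
    rw [stepMean, hs]
    nlinarith

/-! ### Convergence of the balanced system -/

/-- The probability that the balanced system, started at `s`, is not empty at any time up to
`t`. -/
def survival (lam mu : I) : ℕ → ℕ → ℝ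
  | 0, s => if s = 0 then 0 else 1
  | t + 1, s => if s = 0 then 0 else balancedOp lam mu (survival lam mu t) s

theorem survival_nonneg (lam mu : I) (t s : ℕ) : 0 ≤ survival lam mu t s := by
  induction t generalizing s with
  | zero => simp only [survival]; split_ifs <;> norm_num
  | succ t ih =>
    simp only [survival]
    split_ifs
    · exact le_rfl
    · exact integral_nonneg fun w => ih _

theorem balanced_sum (s : ℕ) : balanced s 0 + balanced s 1 = s := by
  simp [balanced]; omega

/-- Each step spent nonempty costs the Lyapunov function `2 * (mu - lam)` on average, so its initial
value bounds the mean emptying time. The level is `2` because both stations of a balanced system are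
busy from two customers on. -/
theorem sum_survival_le {lam mu : I} (hlam : (0 : ℝ) < lam) (hmu : (lam : ℝ) < mu)
    (T s : ℕ) :
    2 * ((mu : ℝ) - lam) * ∑ t ∈ Finset.range T, survival lam mu t s ≤
      lyap (lyapBase lam mu) 2 s := by
  have hγ := one_le_lyapBase hlam hmu
  induction T generalizing s with
  | zero => simpa using lyap_nonneg hγ 2 s
  | succ T ih =>
    rw [Finset.sum_range_succ']
    rcases Nat.eq_zero_or_pos s with rfl | hs
    · simpa [survival] using lyap_nonneg hγ 2 0
    · simp only [survival, hs.ne', if_false]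
      have h1 : ∑ t ∈ Finset.range T, balancedOp lam mu (survival lam mu t) s =
          balancedOp lam mu (fun s => ∑ t ∈ Finset.range T, survival lam mu t s) s := by
        simp only [balancedOp, stepMean]
        rw [integral_finsetSum _ fun _ _ => integrable_stepLaw _ _ _]
      have h2 := balancedOp_le (lam := lam) (mu := mu) ih s
      have h3 := stepMean_lyap_le hlam hmu (R := 2) (x := balanced s)
        (by rw [balanced_sum]; omega) (by rw [balanced_sum]; simp [balanced]; omega)
      rw [balanced_sum] at h3
      have h4 := stepMean_const_mul lam mu (2 * ((mu : ℝ) - lam))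
        (fun s => ∑ t ∈ Finset.range T, survival lam mu t s) (balanced s)
      rw [h1, mul_add, mul_one]
      simp only [balancedOp] at h2 h4 ⊢
      linarith

theorem tendsto_survival {lam mu : I} (hlam : (0 : ℝ) < lam) (hmu : (lam : ℝ) < mu)
    (s : ℕ) : Tendsto (fun t => survival lam mu t s) atTop (𝓝 0) := by
  have he : 0 < 2 * ((mu : ℝ) - lam) := by linarith
  refine (summable_of_sum_range_le (c := lyap (lyapBase lam mu) 2 s / (2 * ((mu : ℝ) - lam)))
    (fun t => survival_nonneg lam mu t s) fun T => ?_).tendsto_atTop_zero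
  rw [le_div_iff₀ he, mul_comm]
  exact sum_survival_le hlam hmu T s

/-- Up to the time when the system empties, the initial state is forgotten. -/
theorem iterate_le_survival {lam mu : I} {f : ℕ → ℝ} (hf : Monotone f) {F : ℝ}
    (hF : ∀ s, f s ≤ f 0 + F) (t s : ℕ) :
    (balancedOp lam mu)^[t] f s ≤ (balancedOp lam mu)^[t] f 0 + F * survival lam mu t s := by
  induction t generalizing s with
  | zero =>
    simp only [Function.iterate_zero, id, survival]
    split_ifs with h
    · simp [h]
    · simpa using hF s
  | succ t ih =>
    simp only [survival]
    split_ifs with h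
    · simp [h]
    · have h1 := iterate_zero_monotone (lam := lam) (mu := mu) hf (Nat.le_succ t)
      simp only at h1
      have h2 := balancedOp_le (lam := lam) (mu := mu) ih s
      simp only [balancedOp] at h2
      rw [stepMean_add, stepMean_const, stepMean_const_mul] at h2
      simp only [Function.iterate_succ_apply'] at h1 ⊢
      simp only [balancedOp] at h1 h2 ⊢
      linarith

/-! ### Tails of the cost -/

/-- The excess of `f` over its value at `N`. -/
def tail (f : ℕ → ℝ) (N s : ℕ) : ℝ := f (max s N) - f N

theorem tail_mono {f : ℕ → ℝ} (hf : Monotone f) (N : ℕ) : Monotone (tail f N) := fun _ _ h =>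
  sub_le_sub_right (hf (max_le_max_right N h)) _

theorem tail_nonneg {f : ℕ → ℝ} (hf : Monotone f) (N s : ℕ) : 0 ≤ tail f N s :=
  sub_nonneg.2 (hf (le_max_right _ _))

theorem min_add_tail {f : ℕ → ℝ} (N s : ℕ) : f (min s N) + tail f N s = f s := by
  rcases le_total s N with h | h <;> simp [tail, h]

/-- Keep only the event that the first `n` steps are all `fill`, which raises the total by `2 * n`.
A shift of the state is thus traded for extra steps and a constant factor. -/
theorem pow_fill_mul_le (lam mu : I) {f : ℕ → ℝ} (hf : Monotone f) (h0 : ∀ s, 0 ≤ f s)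
    (n s : ℕ) :
    (stepLaw lam mu).real {fill} ^ n * f (s + 2 * n) ≤ (balancedOp lam mu)^[n] f s := by
  induction n generalizing s with
  | zero => simp
  | succ n ih =>
    rw [Function.iterate_succ_apply']
    have h1 : (stepLaw lam mu).real {fill} * (balancedOp lam mu)^[n] f (s + 2) ≤
        balancedOp lam mu ((balancedOp lam mu)^[n] f) s := by
      have h2 : ∀ w, Set.indicator {fill} (fun _ => (balancedOp lam mu)^[n] f (s + 2)) w ≤
          (balancedOp lam mu)^[n] f (total (balanced s) w) := by
        have hn : ∀ s, 0 ≤ (balancedOp lam mu)^[n] f s := fun s =>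
          le_trans (mul_nonneg (by positivity) (h0 _)) (ih s)
        intro w
        by_cases hw : w = fill
        · subst hw
          rw [Set.indicator_of_mem (Set.mem_singleton _)]
          refine iterate_monotone hf n ?_
          rw [total_balanced]
          simp [fill]
        · rw [Set.indicator_of_notMem (by simpa using hw)]
          exact hn _
      have h3 := integral_mono (integrable_stepLaw _ _ _) (integrable_stepLaw lam mu _) h2
      rwa [integral_indicator_const _ (by measurability)] at h3
    refine le_trans ?_ h1
    rw [pow_succ', mul_assoc]
    refine mul_le_mul_of_nonneg_left ?_ measureReal_nonneg
    rw [show s + 2 * (n + 1) = s + 2 + 2 * n by ring]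
    exact ih _

theorem iterate_const_mul (lam mu : I) (a : ℝ) (f : ℕ → ℝ) (n : ℕ) :
    (balancedOp lam mu)^[n] (fun s => a * f s) = fun s => a * (balancedOp lam mu)^[n] f s := by
  induction n with
  | zero => rfl
  | succ n ih =>
    simp only [Function.iterate_succ_apply', ih]
    exact funext fun s => stepMean_const_mul _ _ _ _ _

theorem iterate_nonneg (lam mu : I) {f : ℕ → ℝ} (h0 : ∀ s, 0 ≤ f s) (n s : ℕ) :
    0 ≤ (balancedOp lam mu)^[n] f s := by
  induction n generalizing s with
  | zero => exact h0 s
  | succ n ih => rw [Function.iterate_succ_apply']; exact integral_nonneg fun w => ih _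

/-- With certain service the balanced system never exceeds `max s 2`. -/
theorem iterate_eq_zero_of_mu_eq_one (lam : I) {mu : I} (hmu : mu = 1) {f : ℕ → ℝ} {B : ℕ}
    (hB : 2 ≤ B) (hf : ∀ s ≤ B, f s = 0) (n : ℕ) :
    ∀ s ≤ B, (balancedOp lam mu)^[n] f s = 0 := by
  induction n with
  | zero => exact hf
  | succ n ih =>
    intro s hs
    rw [Function.iterate_succ_apply']
    refine integral_eq_zero_of_ae ?_
    filter_upwards [ae_service_of_mu_eq_one lam hmu 0, ae_service_of_mu_eq_one lam hmu 1]
      with w h0 h1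
    refine ih _ ?_
    rw [total_balanced, h0, h1]
    have h2 := Bool.toNat_le (w 0).1
    have h3 := Bool.toNat_le (w 1).1
    simp only [Bool.toNat_true]
    split_ifs <;> omega

/-- The total grows by at most two per step, so only these values of the function are seen. -/
theorem iterate_zero_congr (lam mu : I) {f g : ℕ → ℝ} {t N : ℕ} (h : ∀ s ≤ N + 2 * t, f s = g s) :
    ∀ s ≤ N, (balancedOp lam mu)^[t] f s = (balancedOp lam mu)^[t] g s := by
  induction t generalizing N with
  | zero => simpa using h
  | succ t ih =>
    intro s hs
    simp only [Function.iterate_succ_apply']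
    refine integral_congr_ae (ae_of_all _ fun w => ?_)
    refine ih (N := N + 2) (fun s hs => h s (by omega)) _ ?_
    rw [total_balanced]
    have h2 := Bool.toNat_le (w 0).1
    have h3 := Bool.toNat_le (w 1).1
    omega

/-- If the mean cost of the balanced system started empty stays bounded, then the tails of the cost
are uniformly small, whatever the initial state. -/
theorem tail_uniformly_small {lam mu : I} (hlam : (0 : ℝ) < lam) {f : ℕ → ℝ} (hf : Monotone f)
    {L : ℝ} (hL : Tendsto (fun t => (balancedOp lam mu)^[t] f 0) atTop (𝓝 L)) (K C : ℕ) {δ : ℝ}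
    (hδ : 0 < δ) :
    ∃ N, ∀ᶠ t in atTop, (balancedOp lam mu)^[t] (fun s => tail f N (s + C)) K ≤ δ := by
  rcases eq_or_ne mu 1 with hmu | hmu
  -- With certain service `fill` has probability zero, but the chain stays below `K + 2` and the
  -- tail vanishes.
  · refine ⟨K + 2 + C, Eventually.of_forall fun t => ?_⟩
    rw [iterate_eq_zero_of_mu_eq_one lam hmu (B := K + 2) (by omega) _ t K (by omega)]
    · exact hδ.le
    · intro s hs
      rw [tail, max_eq_right (by omega), sub_self]
  · have hmu1 : (mu : ℝ) < 1 := lt_of_le_of_ne mu.2.2 fun h => hmu (Subtype.ext h)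
    set p := (stepLaw lam mu).real {fill} with hp
    have hp0 : 0 < p := fill_pos hlam hmu1
    have hpp : 0 < p ^ (C + K) := pow_pos hp0 _
    have hmono := iterate_zero_monotone (lam := lam) (mu := mu) hf
    have hle : ∀ t, (balancedOp lam mu)^[t] f 0 ≤ L := fun t => hmono.ge_of_tendsto hL t
    obtain ⟨t₀, ht₀⟩ : ∃ t₀, L - p ^ (C + K) * δ < (balancedOp lam mu)^[t₀] f 0 :=
      (hL.eventually (lt_mem_nhds (by nlinarith))).exists
    -- In `t₀` steps from empty the total is at most `2 * t₀`, so truncating at this level does not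
    -- affect the mean at time `t₀`, already close to `L`.
    refine ⟨2 * t₀, ?_⟩
    filter_upwards [eventually_ge_atTop t₀] with t ht
    set N := 2 * t₀
    have hr := tail_mono hf N
    have hr0 := tail_nonneg hf N
    have h1 : ∀ s, p ^ C * tail f N (s + C) ≤ (balancedOp lam mu)^[C] (tail f N) s := fun s =>
      (mul_le_mul_of_nonneg_left (hr (by omega)) (by positivity)).trans
        (pow_fill_mul_le lam mu hr hr0 C s)
    have h2 : p ^ C * (balancedOp lam mu)^[t] (fun s => tail f N (s + C)) K ≤
        (balancedOp lam mu)^[t] ((balancedOp lam mu)^[C] (tail f N)) K := by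
      refine le_trans (le_of_eq ?_) (iterate_le h1 t K)
      rw [iterate_const_mul]
    rw [← Function.iterate_add_apply] at h2
    have h3 : p ^ K * (balancedOp lam mu)^[t + C] (tail f N) K ≤
        (balancedOp lam mu)^[K + (t + C)] (tail f N) 0 := by
      rw [Function.iterate_add_apply _ K (t + C)]
      refine le_trans (mul_le_mul_of_nonneg_left (iterate_monotone hr _ ?_) (by positivity))
        (pow_fill_mul_le lam mu (iterate_monotone hr _) (iterate_nonneg lam mu hr0 _) K 0)
      omega
    set m := K + (t + C)
    have h4 : (balancedOp lam mu)^[m] f 0 = (balancedOp lam mu)^[m] (fun s => f (min s N)) 0 +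
        (balancedOp lam mu)^[m] (tail f N) 0 := by
      have h := congrFun (iterate_add lam mu (fun s => f (min s N)) (tail f N) m) 0
      simp only [min_add_tail] at h
      exact h
    -- The truncated part has almost exhausted `L` by time `t₀`, hence also by the later time `m`;
    -- at most `p ^ (C + K) * δ` is left for the tail. The factors `p ^ C` and `p ^ K` pay for the
    -- shift `C` and the start `K`.
    have h5 : (balancedOp lam mu)^[t₀] f 0 ≤ (balancedOp lam mu)^[m] (fun s => f (min s N)) 0 := by
      rw [iterate_zero_congr lam mu (N := 0) (g := fun s => f (min s N)) _ 0 le_rfl]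
      · exact iterate_zero_monotone (f := fun s => f (min s N))
          (fun a b h => hf (min_le_min_right _ h)) (by omega)
      · intro s hs
        rw [min_eq_left (by omega)]
    have h6 := hle m
    have h7 : p ^ (C + K) * (balancedOp lam mu)^[t] (fun s => tail f N (s + C)) K ≤
        p ^ (C + K) * δ := by
      calc _ = p ^ K * (p ^ C * (balancedOp lam mu)^[t] (fun s => tail f N (s + C)) K) := by
            rw [pow_add]; ring
        _ ≤ p ^ K * (balancedOp lam mu)^[t + C] (tail f N) K :=
            mul_le_mul_of_nonneg_left h2 (by positivity)
        _ ≤ _ := by linarith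
    exact le_of_mul_le_mul_left h7 hpp

/-! ### Functions of the past -/

instance (lam mu : I) (π : Fin 2 → PMF ℕ) : IsProbabilityMeasure (law lam mu π) := by
  unfold law; infer_instance

/-- `F` depends only on the initial queue lengths and on the arrivals and services before
time `t`. -/
def AdaptedAt {α : Type*} (t : ℕ) (F : Outcome → α) : Prop :=
  ∀ ω ω' : Outcome, ω.1 = ω'.1 → (∀ s < t, ω.2 s = ω'.2 s) → F ω = F ω'

/-- The initial queue lengths and the arrivals and services before time `t`. -/
def truncate (t : ℕ) (ω : Outcome) : (Fin 2 → ℕ) × (Fin t → Step) := (ω.1, fun s => ω.2 s)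

/-- An outcome with the given beginning. -/
def extend (t : ℕ) (y : (Fin 2 → ℕ) × (Fin t → Step)) : Outcome :=
  (y.1, fun s => if h : s < t then y.2 ⟨s, h⟩ else drain)

theorem AdaptedAt.eq_extend {α : Type*} {t : ℕ} {F : Outcome → α} (hF : AdaptedAt t F)
    (ω : Outcome) : F ω = F (extend t (truncate t ω)) :=
  hF _ _ rfl fun s hs => by simp [extend, truncate, hs]

theorem measurable_truncate (t : ℕ) : Measurable (truncate t) := by
  unfold truncate
  fun_prop

/-- Such a function factors through the countable discrete space of pasts. -/
theorem AdaptedAt.measurable {α : Type*} [MeasurableSpace α] {t : ℕ} {F : Outcome → α}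
    (hF : AdaptedAt t F) : Measurable F := by
  have h : F = (fun y => F (extend t y)) ∘ truncate t := funext hF.eq_extend
  rw [h]
  exact Measurable.of_discrete.comp (measurable_truncate t)

theorem AdaptedAt.mono {α : Type*} {s t : ℕ} {F : Outcome → α} (hF : AdaptedAt s F)
    (hst : s ≤ t) : AdaptedAt t F := fun ω ω' h1 h2 => hF ω ω' h1 fun r hr => h2 r (by omega)

theorem AdaptedAt.comp {α β : Type*} {t : ℕ} {F : Outcome → α} (hF : AdaptedAt t F) (f : α → β) :
    AdaptedAt t fun ω => f (F ω) := fun ω ω' h1 h2 => congrArg f (hF ω ω' h1 h2)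

theorem AdaptedAt.comp₂ {α β γ : Type*} {t : ℕ} {F : Outcome → α} {G : Outcome → β}
    (hF : AdaptedAt t F) (hG : AdaptedAt t G) (f : α → β → γ) :
    AdaptedAt t fun ω => f (F ω) (G ω) := fun ω ω' h1 h2 => by
  simp only [hF ω ω' h1 h2, hG ω ω' h1 h2]

theorem ae_initial_le (lam mu : I) {π : Fin 2 → PMF ℕ} {M : ℕ}
    (hM : ∀ i x, M < x → π i x = 0) : ∀ᵐ ω ∂law lam mu π, ∀ i, ω.1 i ≤ M := by
  rw [ae_all_iff]
  intro i
  have h1 : MeasurePreserving (fun ω : Outcome => ω.1 i) (law lam mu π) (π i).toMeasure :=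
    (measurePreserving_eval (fun i => (π i).toMeasure) i).comp measurePreserving_fst
  have h2 : ∀ᵐ x ∂(π i).toMeasure, x ≤ M := by
    rw [ae_iff, PMF.toMeasure_apply_eq_zero_iff _ (by measurability), Set.disjoint_left]
    intro x hx hx2
    exact hx (hM i x (by simpa using hx2))
  exact h1.quasiMeasurePreserving.ae h2

/-- With bounded initial lengths only finitely many pasts occur almost surely, so the function is
almost surely bounded. -/
theorem AdaptedAt.integrable {lam mu : I} {π : Fin 2 → PMF ℕ} {M : ℕ}
    (hM : ∀ i x, M < x → π i x = 0) {t : ℕ} {F : Outcome → ℝ} (hF : AdaptedAt t F) :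
    Integrable F (law lam mu π) := by
  set S : Set ((Fin 2 → ℕ) × (Fin t → Step)) := (Set.univ.pi fun _ => Set.Iic M) ×ˢ Set.univ
  have hS : S.Finite :=
    (Set.Finite.pi fun _ => Set.finite_Iic M).prod Set.finite_univ
  obtain ⟨C, hC⟩ := (hS.image fun y => ‖F (extend t y)‖).bddAbove
  refine Integrable.of_bound hF.measurable.aestronglyMeasurable C ?_
  filter_upwards [ae_initial_le lam mu hM] with ω hω
  rw [hF.eq_extend]
  exact hC ⟨truncate t ω, ⟨fun i _ => hω i, trivial⟩, rfl⟩

/-! ### Resampling one time step -/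

/-- The outcome `ω` with the arrivals and services at time `t` replaced by `w`. -/
def resample (t : ℕ) (ω : Outcome) (w : Step) : Outcome := (ω.1, Function.update ω.2 t w)

theorem AdaptedAt.resample {α : Type*} {t : ℕ} {F : Outcome → α} (hF : AdaptedAt t F)
    (ω : Outcome) (w : Step) : F (resample t ω w) = F ω :=
  hF _ _ rfl fun s hs => by simp [Routing.resample, hs.ne]

/-- Overwriting one coordinate of an i.i.d. family with an independent copy preserves its law. On
boxes, the factor of coordinate `i` is simply supplied by the copy. -/
theorem measurePreserving_update {ι X : Type*} [DecidableEq ι] [MeasurableSpace X]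
    (ν : Measure X) [IsProbabilityMeasure ν] (i : ι) :
    MeasurePreserving (fun p : (ι → X) × X => Function.update p.1 i p.2)
      ((Measure.infinitePi fun _ : ι => ν).prod ν) (Measure.infinitePi fun _ : ι => ν) := by
  have hm : Measurable fun p : (ι → X) × X => Function.update p.1 i p.2 := by
    refine measurable_pi_lambda _ fun j => ?_
    by_cases h : j = i
    · subst h; simpa using measurable_snd
    · simp only [Function.update_of_ne h]; fun_prop
  refine ⟨hm, Measure.eq_infinitePi _ fun s T hT => ?_⟩
  rw [Measure.map_apply hm (MeasurableSet.pi s.countable_toSet fun j _ => hT j)]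
  by_cases hi : i ∈ s
  · have : (fun p : (ι → X) × X => Function.update p.1 i p.2) ⁻¹' (Set.pi s T) =
        (Set.pi (s.erase i : Finset ι) T) ×ˢ T i := by
      ext p
      simp only [Set.mem_preimage, Set.mem_pi, Set.mem_prod, Finset.mem_coe, Finset.mem_erase]
      constructor
      · intro h
        refine ⟨fun j hj => ?_, ?_⟩
        · simpa [hj.1] using h j hj.2
        · simpa using h i hi
      · rintro ⟨h1, h2⟩ j hj
        by_cases hji : j = i
        · subst hji; simpa using h2
        · simpa [hji] using h1 j ⟨hji, hj⟩
    rw [this, Measure.prod_prod, Measure.infinitePi_pi (fun _ => ν) fun j _ => hT j,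
      Finset.prod_erase_mul s (fun j => ν (T j)) hi]
  · have : (fun p : (ι → X) × X => Function.update p.1 i p.2) ⁻¹' (Set.pi s T) =
        (Set.pi s T) ×ˢ Set.univ := by
      ext p
      simp only [Set.mem_preimage, Set.mem_pi, Set.mem_prod, Finset.mem_coe, Set.mem_univ, and_true]
      refine forall₂_congr fun j hj => ?_
      rw [Function.update_of_ne fun (h : j = i) => hi (by rwa [← h])]
    rw [this, Measure.prod_prod, Measure.infinitePi_pi (fun _ => ν) fun j _ => hT j, measure_univ,
      mul_one]

theorem measurePreserving_resample (lam mu : I) (π : Fin 2 → PMF ℕ) (t : ℕ) :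
    MeasurePreserving (fun p : Outcome × Step => resample t p.1 p.2)
      ((law lam mu π).prod (stepLaw lam mu)) (law lam mu π) := by
  have h1 := measurePreserving_prodAssoc (Measure.pi fun i => (π i).toMeasure)
    (Measure.infinitePi fun _ : ℕ => stepLaw lam mu) (stepLaw lam mu)
  have h2 := (MeasurePreserving.id (Measure.pi fun i => (π i).toMeasure)).prod
    (measurePreserving_update (ι := ℕ) (stepLaw lam mu) t)
  exact h2.comp h1

/-- Conditionally on the past, the arrivals and services at time `t` have the law `stepLaw`. -/
theorem integral_step {lam mu : I} {π : Fin 2 → PMF ℕ} {M : ℕ}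
    (hM : ∀ i x, M < x → π i x = 0) {t : ℕ} {α : Type*} {k : Outcome → α} (hk : AdaptedAt t k)
    (Ψ : α → Step → ℝ) :
    ∫ ω, Ψ (k ω) (ω.2 t) ∂law lam mu π =
      ∫ ω, (∫ w, Ψ (k ω) w ∂stepLaw lam mu) ∂law lam mu π := by
  have hF : AdaptedAt (t + 1) fun ω => Ψ (k ω) (ω.2 t) := fun ω ω' h1 h2 => by
    simp only [hk ω ω' h1 fun s hs => h2 s (by omega), h2 t (by omega)]
  have hp := measurePreserving_resample lam mu π t
  have hi := hF.integrable (lam := lam) (mu := mu) hM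
  have hi2 := (hp.integrable_comp hi.aestronglyMeasurable).2 hi
  -- Represent `law` as the image under resampling at time `t`; `k` does not see the new step, so
  -- Fubini applies.
  rw [← hp.map_eq, integral_map hp.aemeasurable (by rw [hp.map_eq]; exact hi.aestronglyMeasurable),
    hp.map_eq]
  simp only [Function.comp_def, hk.resample] at hi2 ⊢
  rw [integral_prod _ hi2]
  simp [resample]

/-! ### Adaptedness of the dynamics -/

theorem queue_agree {ω ω' : Outcome} {u u' : ℕ → Fin 2 → Bool} {t : ℕ} (h0 : ω.1 = ω'.1)
    (h1 : ∀ s < t, ω.2 s = ω'.2 s) (h2 : ∀ s < t, u s = u' s) : queue ω u t = queue ω' u' t := by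
  induction t with
  | zero => exact h0
  | succ t ih =>
    funext i
    have h3 := ih (fun s hs => h1 s (by omega)) fun s hs => h2 s (by omega)
    simp only [queue, afterService, arrival, service, h3, h1 t (by omega), h2 t (by omega)]

theorem past_adaptedAt (g : Policy) (t : ℕ) : AdaptedAt t fun ω => past g ω t := by
  induction t with
  | zero => exact fun _ _ _ _ => rfl
  | succ t ih =>
    intro ω ω' h0 h1
    have hp : past g ω t = past g ω' t := ih ω ω' h0 fun s hs => h1 s (by omega)
    have hq : ∀ s : Fin (t + 1), queue ω (past g ω' t) s = queue ω' (past g ω' t) s := fun s =>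
      queue_agree h0 (fun r hr => h1 r (by omega)) fun _ _ => rfl
    have hi : ∀ i, info ω (past g ω' t) i t = info ω' (past g ω' t) i t := by
      intro i
      have h3 : ∀ s : Fin (t + 1), ω.2 s = ω'.2 s := fun s => h1 s s.2
      simp only [info, queueBar, afterService, arrival, service, hq, h3]
    simp only [past, hp, hi]

theorem action_adaptedAt (g : Policy) (t : ℕ) : AdaptedAt (t + 1) fun ω => action g ω t :=
  (past_adaptedAt g (t + 1)).comp fun u => u t

theorem X_adaptedAt (g : Policy) (t : ℕ) : AdaptedAt t fun ω => X g ω t := fun ω ω' h0 h1 =>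
  queue_agree h0 h1 fun s hs =>
    (action_adaptedAt g s) ω ω' h0 fun r hr => h1 r (by omega)

/-- The decisions before time `t`. -/
def history (g : Policy) (t : ℕ) (ω : Outcome) : Fin t → Fin 2 → Bool := fun s => action g ω s

theorem history_adaptedAt (g : Policy) (t : ℕ) : AdaptedAt t (history g t) := fun ω ω' h0 h1 =>
  funext fun s => (action_adaptedAt g s) ω ω' h0 fun r hr => h1 r (by omega)

theorem Xbar_eq (g : Policy) (ω : Outcome) (t : ℕ) (i : Fin 2) :
    Xbar g ω t i = (X g ω t i - (ω.2 t i).2.toNat) + (ω.2 t i).1.toNat := rfl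

theorem X_succ (g : Policy) (ω : Outcome) (t : ℕ) (i : Fin 2) :
    X g ω (t + 1) i = Xbar g ω t i - (action g ω t i).toNat + (action g ω t (1 - i)).toNat := rfl

/-- The total queue length under the policy `g`. -/
def totalX (g : Policy) (t : ℕ) (ω : Outcome) : ℕ := X g ω t 0 + X g ω t 1

theorem totalX_adaptedAt (g : Policy) (t : ℕ) : AdaptedAt t (totalX g t) :=
  (X_adaptedAt g t).comp fun x => x 0 + x 1

/-- Feasibility excludes `0 - 1 = 0` in the dynamics, where truncated subtraction would create a
customer. -/
theorem action_le_Xbar {g : Policy} (hg : Feasible g) (ω : Outcome) (t : ℕ) (i : Fin 2) :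
    (action g ω t i).toNat ≤ Xbar g ω t i := by
  rcases Nat.eq_zero_or_pos (Xbar g ω t i) with h | h
  · have : action g ω t i = false := by
      rw [action_eq]
      exact hg i t _ h
    simp [this]
  · exact (Bool.toNat_le _).trans h

/-- Routing preserves the total queue length. -/
theorem totalX_succ {g : Policy} (hg : Feasible g) (ω : Outcome) (t : ℕ) :
    totalX g (t + 1) ω = total (X g ω t) (ω.2 t) := by
  have h0 := action_le_Xbar hg ω t 0
  have h1 := action_le_Xbar hg ω t 1
  have e0 := Xbar_eq g ω t 0
  have e1 := Xbar_eq g ω t 1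
  have f0 := X_succ g ω t 0
  have f1 := X_succ g ω t 1
  simp only [sub_zero, sub_self] at f0 f1
  rw [totalX, total]
  omega

theorem integral_totalX_succ {lam mu : I} {π : Fin 2 → PMF ℕ} {M : ℕ}
    (hM : ∀ i x, M < x → π i x = 0) {g : Policy} (hg : Feasible g) (t : ℕ) (f : ℕ → ℝ) :
    ∫ ω, f (totalX g (t + 1) ω) ∂law lam mu π =
      ∫ ω, stepMean lam mu f (X g ω t) ∂law lam mu π := by
  simp only [totalX_succ hg]
  exact integral_step hM (X_adaptedAt g t) fun x w => f (total x w)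

/-- The total queue length under any policy dominates the one of a balanced system started
empty. -/
theorem iterate_le_integral {lam mu : I} {π : Fin 2 → PMF ℕ} {M : ℕ}
    (hM : ∀ i x, M < x → π i x = 0) {g : Policy} (hg : Feasible g) {f : ℕ → ℝ} (hf : Monotone f)
    (t : ℕ) : (balancedOp lam mu)^[t] f 0 ≤ ∫ ω, f (totalX g t ω) ∂law lam mu π := by
  induction t generalizing f with
  | zero =>
    have h := integral_mono (μ := law lam mu π) (integrable_const (f 0))
      (((totalX_adaptedAt g 0).comp f).integrable hM) fun ω => hf (Nat.zero_le _)
    simpa using h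
  | succ t ih =>
    rw [integral_totalX_succ hM hg, Function.iterate_succ_apply]
    -- The last step is peeled off and absorbed into the test function, hence the induction over all
    -- monotone `f`.
    refine (ih (balancedOp_monotone hf)).trans (integral_mono
      (((totalX_adaptedAt g t).comp _).integrable hM) (((X_adaptedAt g t).comp _).integrable hM)
      fun ω => balancedOp_le_stepMean hf _)

/-! ### The balanced cost -/

/-- The holding cost of the balanced configuration of `s` customers. -/
def balancedCost (c : ℕ → ℝ) (s : ℕ) : ℝ := c ((s + 1) / 2) + c (s / 2)

theorem balancedCost_mono {c : ℕ → ℝ} (hc : Monotone c) : Monotone (balancedCost c) := fun _ _ h =>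
  add_le_add (hc (by omega)) (hc (by omega))

/-- By convexity, moving a customer from the longer to the shorter queue does not raise the cost;
this reduces the difference by two until it is `0` or `1`. -/
theorem balancedCost_le_add {c : ℕ → ℝ} (hc : ∀ n, c (n + 1) - c n ≤ c (n + 2) - c (n + 1))
    (a b : ℕ) : balancedCost c (a + b) ≤ c a + c b := by
  have hmono : Monotone fun n => c (n + 1) - c n := monotone_nat_of_le_succ hc
  have key : ∀ d a, balancedCost c (a + (a + d)) ≤ c a + c (a + d) := by
    intro d
    induction d using Nat.strong_induction_on with
    | _ d ih =>
      intro a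
      match d with
      | 0 => rw [balancedCost, show (a + (a + 0) + 1) / 2 = a by omega,
          show (a + (a + 0)) / 2 = a by omega]; simp
      | 1 => rw [balancedCost, show (a + (a + 1) + 1) / 2 = a + 1 by omega,
          show (a + (a + 1)) / 2 = a by omega, add_comm]
      | d + 2 =>
        have h1 := ih d (by omega) (a + 1)
        have h2 : c (a + 1) - c a ≤ c (a + d + 1 + 1) - c (a + d + 1) := hmono (by omega)
        rw [show a + 1 + (a + 1 + d) = a + (a + (d + 2)) by ring,
          show a + 1 + d = a + d + 1 by ring] at h1
        rw [show a + (d + 2) = a + d + 1 + 1 by ring] at h1 ⊢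
        linarith
  rcases le_total a b with h | h
  · obtain ⟨d, rfl⟩ := Nat.exists_eq_add_of_le h
    exact key d a
  · obtain ⟨d, rfl⟩ := Nat.exists_eq_add_of_le h
    rw [add_comm, add_comm (c _)]
    exact key d b

theorem add_eq_balancedCost (c : ℕ → ℝ) {a b : ℕ} (h0 : a ≤ b + 1) (h1 : b ≤ a + 1) :
    c a + c b = balancedCost c (a + b) := by
  rw [balancedCost]
  rcases le_total a b with h | h
  · rw [show (a + b + 1) / 2 = b by omega, show (a + b) / 2 = a by omega, add_comm]
  · rw [show (a + b + 1) / 2 = a by omega, show (a + b) / 2 = b by omega]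

/-- Each queue is at most half of the total plus `W`. This crude bound serves while the queues are
not yet balanced. -/
theorem add_le_balancedCost {c : ℕ → ℝ} (hc : Monotone c) {a b W : ℕ} (h0 : a ≤ b + W)
    (h1 : b ≤ a + W) : c a + c b ≤ balancedCost c (a + b + (W + 1)) :=
  add_le_add (hc (by omega)) (hc (by omega))

/-- The expected holding cost at time `t`. -/
def stageCost (lam mu : I) (c : ℕ → ℝ) (π : Fin 2 → PMF ℕ) (g : Policy) (t : ℕ) : ℝ :=
  ∫ ω, (c (X g ω t 0) + c (X g ω t 1)) ∂law lam mu π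

theorem cost_adaptedAt (c : ℕ → ℝ) (g : Policy) (t : ℕ) :
    AdaptedAt t fun ω => c (X g ω t 0) + c (X g ω t 1) :=
  (X_adaptedAt g t).comp fun x => c (x 0) + c (x 1)

theorem horizonCost_eq_sum {lam mu : I} {π : Fin 2 → PMF ℕ} {M : ℕ}
    (hM : ∀ i x, M < x → π i x = 0) (c : ℕ → ℝ) (g : Policy) (T : ℕ) :
    horizonCost lam mu c π g T = ∑ t ∈ Finset.range T, stageCost lam mu c π g t :=
  integral_finsetSum _ fun t _ => (cost_adaptedAt c g t).integrable hM

theorem iterate_le_stageCost {lam mu : I} {π : Fin 2 → PMF ℕ} {M : ℕ}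
    (hM : ∀ i x, M < x → π i x = 0) {g : Policy} (hg : Feasible g) {c : ℕ → ℝ} (hc : Monotone c)
    (hc' : ∀ n, c (n + 1) - c n ≤ c (n + 2) - c (n + 1)) (t : ℕ) :
    (balancedOp lam mu)^[t] (balancedCost c) 0 ≤ stageCost lam mu c π g t :=
  (iterate_le_integral hM hg (balancedCost_mono hc) t).trans (integral_mono
    (((totalX_adaptedAt g t).comp _).integrable hM) ((cost_adaptedAt c g t).integrable hM)
    fun _ => balancedCost_le_add hc' _ _)

/-! ### Supports of the conditional distributions -/

theorem pastEvent_eq (g : Policy) (t : ℕ) (u : Fin t → Fin 2 → Bool) :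
    pastEvent g t u = history g t ⁻¹' {u} := rfl

theorem measurableSet_pastEvent (g : Policy) (t : ℕ) (u : Fin t → Fin 2 → Bool) :
    MeasurableSet (pastEvent g t u) :=
  (history_adaptedAt g t).measurable (measurableSet_singleton u)

theorem condPMF_ne_zero_iff {lam mu : I} {π : Fin 2 → PMF ℕ} {g : Policy} {i : Fin 2} {t : ℕ}
    {u : Fin t → Fin 2 → Bool} {x : ℕ} :
    condPMF lam mu π g i t u x ≠ 0 ↔
      law lam mu π (pastEvent g t u ∩ {ω | Xbar g ω t i = x}) ≠ 0 := by
  rw [condPMF, cond_apply (measurableSet_pastEvent g t u)]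
  simp [measure_ne_top]

/-- The countably many values of probability zero have null union. -/
theorem ae_measure_fiber_ne_zero {Ω β : Type*} [MeasurableSpace Ω] [Countable β] (P : Measure Ω)
    (F : Ω → β) : ∀ᵐ ω ∂P, P (F ⁻¹' {F ω}) ≠ 0 := by
  rw [ae_iff]
  have h : {ω | ¬P (F ⁻¹' {F ω}) ≠ 0} ⊆ ⋃ b : {b // P (F ⁻¹' {b}) = 0}, F ⁻¹' {b.1} := fun ω hω =>
    Set.mem_iUnion.2 ⟨⟨F ω, not_not.1 hω⟩, rfl⟩
  exact measure_mono_null h (measure_iUnion_null fun b => b.2)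

/-- The outcomes that avoid all events of probability zero relevant to the supports. -/
def Regular (lam mu : I) (π : Fin 2 → PMF ℕ) (g : Policy) (M : ℕ) (ω : Outcome) : Prop :=
  (∀ i, ω.1 i ≤ M) ∧ ∀ t i, condPMF lam mu π g i t (history g t ω) (Xbar g ω t i) ≠ 0

/-! ### Pathwise description of the supports -/

section Regular

variable {lam mu : I} {π : Fin 2 → PMF ℕ} {g : Policy} {M : ℕ} {ω : Outcome}

theorem ae_regular (hM : ∀ i x, M < x → π i x = 0) (g : Policy) :
    ∀ᵐ ω ∂law lam mu π, Regular lam mu π g M ω := by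
  refine (ae_initial_le lam mu hM).and ?_
  rw [ae_all_iff]
  intro t
  rw [ae_all_iff]
  intro i
  filter_upwards [ae_measure_fiber_ne_zero (law lam mu π)
    fun ω => (history g t ω, Xbar g ω t i)] with ω hω
  rw [condPMF_ne_zero_iff]
  convert hω using 2
  ext ω'
  simp [pastEvent_eq]

theorem Regular.measure_pastEvent_ne_zero (h : Regular lam mu π g M ω) (t : ℕ) :
    law lam mu π (pastEvent g t (history g t ω)) ≠ 0 := fun h0 =>
  condPMF_ne_zero_iff.1 (h.2 t 0) (measure_mono_null Set.inter_subset_left h0)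

theorem X_le (g : Policy) (h : ∀ i, ω.1 i ≤ M) (t : ℕ) (i : Fin 2) : X g ω t i ≤ M + 2 * t := by
  induction t generalizing i with
  | zero => exact h i
  | succ t ih =>
    have h1 := ih i
    have h2 := X_succ g ω t i
    have h3 := Xbar_eq g ω t i
    have h4 := Bool.toNat_le (action g ω t (1 - i))
    have h5 := Bool.toNat_le (ω.2 t i).1
    omega

theorem Xbar_le (g : Policy) (h : ∀ i, ω.1 i ≤ M) (t : ℕ) (i : Fin 2) :
    Xbar g ω t i ≤ M + 2 * t + 1 := by
  have h1 := X_le g h t i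
  have h3 := Xbar_eq g ω t i
  have h5 := Bool.toNat_le (ω.2 t i).1
  omega

/-- An event of positive probability is not contained in the null set of irregular outcomes. Support
points are therefore attained on actual paths, and pathwise estimates bound the supports. -/
theorem exists_regular (hM : ∀ i x, M < x → π i x = 0) {i : Fin 2} {t : ℕ}
    {u : Fin t → Fin 2 → Bool} {x : ℕ} (h : condPMF lam mu π g i t u x ≠ 0) :
    ∃ ω, Regular lam mu π g M ω ∧ history g t ω = u ∧ Xbar g ω t i = x := by
  by_contra hcon
  push Not at hcon
  exact condPMF_ne_zero_iff.1 h (measure_mono_null (fun ω hω hr => hcon ω hr hω.1 hω.2)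
    (ae_iff.1 (ae_regular (lam := lam) (mu := mu) hM g)))

theorem bddAbove_support (hM : ∀ i x, M < x → π i x = 0) (i : Fin 2) (t : ℕ)
    (u : Fin t → Fin 2 → Bool) : BddAbove {x | condPMF lam mu π g i t u x ≠ 0} := by
  refine ⟨M + 2 * t + 1, fun x hx => ?_⟩
  obtain ⟨ω, hr, -, rfl⟩ := exists_regular hM hx
  exact Xbar_le g hr.1 t i

/-- The largest point of the supports of the conditional laws of the two queue lengths. -/
def supportMax (lam mu : I) (π : Fin 2 → PMF ℕ) (g : Policy) (t : ℕ) (ω : Outcome) : ℕ :=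
  max (upper lam mu π g 0 t (history g t ω)) (upper lam mu π g 1 t (history g t ω))

/-- The smallest point of the supports of the conditional laws of the two queue lengths. -/
def supportMin (lam mu : I) (π : Fin 2 → PMF ℕ) (g : Policy) (t : ℕ) (ω : Outcome) : ℕ :=
  min (lower lam mu π g 0 t (history g t ω)) (lower lam mu π g 1 t (history g t ω))

theorem Regular.le_supportMax (hM : ∀ i x, M < x → π i x = 0) (h : Regular lam mu π g M ω)
    (t : ℕ) (i : Fin 2) : Xbar g ω t i ≤ supportMax lam mu π g t ω := by
  have h1 : Xbar g ω t i ≤ upper lam mu π g i t (history g t ω) :=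
    le_csSup (bddAbove_support hM i t _) (h.2 t i)
  fin_cases i
  · exact h1.trans (le_max_left _ _)
  · exact h1.trans (le_max_right _ _)

theorem Regular.supportMin_le (h : Regular lam mu π g M ω) (t : ℕ) (i : Fin 2) :
    supportMin lam mu π g t ω ≤ Xbar g ω t i := by
  have h1 : lower lam mu π g i t (history g t ω) ≤ Xbar g ω t i := Nat.sInf_le (h.2 t i)
  fin_cases i
  · exact (min_le_left _ _).trans h1
  · exact (min_le_right _ _).trans h1

theorem Regular.exists_eq_supportMax (hM : ∀ i x, M < x → π i x = 0)
    (h : Regular lam mu π g M ω) (t : ℕ) :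
    ∃ ω' i, Regular lam mu π g M ω' ∧ history g t ω' = history g t ω ∧
      Xbar g ω' t i = supportMax lam mu π g t ω := by
  have key : ∀ i, ∃ ω', Regular lam mu π g M ω' ∧ history g t ω' = history g t ω ∧
      Xbar g ω' t i = upper lam mu π g i t (history g t ω) := fun i =>
    exists_regular hM (Nat.sSup_mem ⟨_, h.2 t i⟩ (bddAbove_support hM i t _))
  rcases max_choice (upper lam mu π g 0 t (history g t ω))
    (upper lam mu π g 1 t (history g t ω)) with hc | hc
  · obtain ⟨ω', h1, h2, h3⟩ := key 0
    exact ⟨ω', 0, h1, h2, by rw [h3, supportMax, hc]⟩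
  · obtain ⟨ω', h1, h2, h3⟩ := key 1
    exact ⟨ω', 1, h1, h2, by rw [h3, supportMax, hc]⟩

theorem Regular.exists_eq_supportMin (hM : ∀ i x, M < x → π i x = 0)
    (h : Regular lam mu π g M ω) (t : ℕ) :
    ∃ ω' i, Regular lam mu π g M ω' ∧ history g t ω' = history g t ω ∧
      Xbar g ω' t i = supportMin lam mu π g t ω := by
  have key : ∀ i, ∃ ω', Regular lam mu π g M ω' ∧ history g t ω' = history g t ω ∧
      Xbar g ω' t i = lower lam mu π g i t (history g t ω) := fun i =>
    exists_regular hM (Nat.sInf_mem (s := {x | condPMF lam mu π g i t (history g t ω) x ≠ 0})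
      ⟨_, h.2 t i⟩)
  rcases min_choice (lower lam mu π g 0 t (history g t ω))
    (lower lam mu π g 1 t (history g t ω)) with hc | hc
  · obtain ⟨ω', h1, h2, h3⟩ := key 0
    exact ⟨ω', 0, h1, h2, by rw [h3, supportMin, hc]⟩
  · obtain ⟨ω', h1, h2, h3⟩ := key 1
    exact ⟨ω', 1, h1, h2, by rw [h3, supportMin, hc]⟩

/-! ### Feasibility of the threshold policy -/

open scoped Classical in
/-- Arrivals make the queue at station `0` nonempty with positive conditional probability. -/
theorem exists_pos_mem_support (hM : ∀ i x, M < x → π i x = 0) (hlam : (0 : ℝ) < lam) {t : ℕ}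
    {u : Fin t → Fin 2 → Bool} (hu : law lam mu π (pastEvent g t u) ≠ 0) :
    ∃ x, 1 ≤ x ∧ condPMF lam mu π g 0 t u x ≠ 0 := by
  by_contra hcon
  push Not at hcon
  have h1 : ∀ᵐ ω ∂law lam mu π, ∀ x, 1 ≤ x → ¬(history g t ω = u ∧ Xbar g ω t 0 = x) := by
    rw [ae_all_iff]
    intro x
    by_cases hx : 1 ≤ x
    · have h2 := not_not.1 (mt condPMF_ne_zero_iff.2 (not_not.2 (hcon x hx)))
      simp only [hx, forall_const]
      rw [ae_iff]
      simpa [pastEvent_eq, Set.inter_def] using h2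
    · simp [hx]
  -- The mean of the arrival indicator on the past event is `lam` times its probability, yet it
  -- would vanish if the queue were almost surely empty there.
  have h2 := integral_step (lam := lam) (mu := mu) hM (history_adaptedAt g t)
    fun v w => if v = u then ((w 0).1.toNat : ℝ) else 0
  have h3 : ∫ ω, (if history g t ω = u then ((ω.2 t 0).1.toNat : ℝ) else 0) ∂law lam mu π = 0 := by
    refine integral_eq_zero_of_ae ?_
    filter_upwards [h1] with ω hω
    split_ifs with h
    · have h4 := hω (Xbar g ω t 0)
      have h5 := Xbar_eq g ω t 0
      have h6 : (ω.2 t 0).1.toNat = 0 := by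
        by_contra h7
        exact h4 (by omega) ⟨h, rfl⟩
      simp [h6]
    · rfl
  have h4 : ∀ ω, (∫ w, (if history g t ω = u then ((w 0).1.toNat : ℝ) else 0) ∂stepLaw lam mu) =
      (pastEvent g t u).indicator (fun _ => (lam : ℝ)) ω := by
    intro ω
    by_cases h : history g t ω = u
    · rw [Set.indicator_of_mem (show ω ∈ pastEvent g t u from h)]
      simp only [h, if_true, integral_arrival]
    · rw [Set.indicator_of_notMem (show ω ∉ pastEvent g t u from h)]
      simp [h]
  simp only [h4] at h2
  rw [h3, integral_indicator_const _ (measurableSet_pastEvent g t u), smul_eq_mul, eq_comm,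
    mul_eq_zero, or_iff_left hlam.ne', measureReal_eq_zero_iff] at h2
  exact hu h2

/-- The union of the supports reaches at least `1`, so the midpoint is positive and an empty queue
lies below it. -/
theorem feasible_of_eq_thresholdRule (hM : ∀ i x, M < x → π i x = 0) (hlam : (0 : ℝ) < lam)
    (hg : g = thresholdRule lam mu π g) : Feasible g := by
  intro i t h h0
  rw [hg]
  simp only [thresholdRule, h0, decide_eq_false_iff_not, not_and, not_le]
  intro hu
  obtain ⟨x, hx1, hx⟩ := exists_pos_mem_support hM hlam hu
  have h1 : 1 ≤ upper lam mu π g 0 t h.u := hx1.trans (le_csSup (bddAbove_support hM 0 t _) hx)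
  have h2 : (1 : ℝ) ≤ (max (upper lam mu π g 0 t h.u) (upper lam mu π g 1 t h.u) : ℕ) := by
    exact_mod_cast h1.trans (le_max_left _ _)
  rw [threshold, Nat.cast_zero]
  positivity

theorem Regular.one_le_supportMax (hM : ∀ i x, M < x → π i x = 0) (hlam : (0 : ℝ) < lam)
    (h : Regular lam mu π g M ω) (t : ℕ) : 1 ≤ supportMax lam mu π g t ω := by
  obtain ⟨x, hx1, hx⟩ := exists_pos_mem_support hM hlam (h.measure_pastEvent_ne_zero t)
  exact (hx1.trans (le_csSup (bddAbove_support hM 0 t _) hx)).trans (le_max_left _ _)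

/-! ### Shrinking of the supports -/

theorem Regular.action_iff (hg : g = thresholdRule lam mu π g) (h : Regular lam mu π g M ω)
    (t : ℕ) (i : Fin 2) : action g ω t i = true ↔
      supportMax lam mu π g t ω + supportMin lam mu π g t ω ≤ 2 * Xbar g ω t i := by
  have h1 : action g ω t i = thresholdRule lam mu π g i t (info ω (action g ω) i t) := by
    rw [← hg]; exact action_eq g ω t i
  have h2 : law lam mu π (pastEvent g t (info ω (action g ω) i t).u) ≠ 0 :=
    h.measure_pastEvent_ne_zero t
  rw [h1, thresholdRule, decide_eq_true_iff, and_iff_right h2, threshold,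
    div_le_iff₀ (by norm_num), ← Nat.cast_add, mul_comm]
  change ((_ : ℕ) : ℝ) ≤ 2 * (Xbar g ω t i : ℝ) ↔ _
  exact_mod_cast Iff.rfl

theorem history_succ {ω' : Outcome} {t : ℕ} (h : history g (t + 1) ω' = history g (t + 1) ω) :
    history g t ω' = history g t ω ∧ action g ω' t = action g ω t :=
  ⟨funext fun s => congrFun h s.castSucc, congrFun h (Fin.last t)⟩

/-- The width of the union of the supports of the conditional laws of the queue lengths. -/
def spread (lam mu : I) (π : Fin 2 → PMF ℕ) (g : Policy) (t : ℕ) (ω : Outcome) : ℕ :=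
  supportMax lam mu π g t ω - supportMin lam mu π g t ω

theorem spread_adaptedAt (lam mu : I) (π : Fin 2 → PMF ℕ) (g : Policy) (t : ℕ) :
    AdaptedAt t (spread lam mu π g t) := fun ω ω' h0 h1 => by
  simp only [spread, supportMax, supportMin, history_adaptedAt g t ω ω' h0 h1]

/-- The bounds that the decisions at time `t` impose on the queue lengths at time `t + 1`. -/
theorem Regular.bounds (hM : ∀ i x, M < x → π i x = 0) (hlam : (0 : ℝ) < lam)
    (hg : g = thresholdRule lam mu π g) {ω' : Outcome} (h' : Regular lam mu π g M ω')
    {t : ℕ} (hh : history g t ω' = history g t ω) (ha : action g ω' t = action g ω t)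
    (i : Fin 2) :
    X g ω' (t + 1) i + (action g ω t i).toNat =
        Xbar g ω' t i + (action g ω t (1 - i)).toNat ∧
      (action g ω t i = true ↔
        supportMax lam mu π g t ω + supportMin lam mu π g t ω ≤ 2 * Xbar g ω' t i) ∧
      supportMin lam mu π g t ω ≤ Xbar g ω' t i ∧
      Xbar g ω' t i ≤ supportMax lam mu π g t ω := by
  have e1 : supportMax lam mu π g t ω' = supportMax lam mu π g t ω := by simp only [supportMax, hh]
  have e2 : supportMin lam mu π g t ω' = supportMin lam mu π g t ω := by simp only [supportMin, hh]
  have h1 := action_le_Xbar (feasible_of_eq_thresholdRule hM hlam hg) ω' t i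
  have h2 := X_succ g ω' t i
  rw [ha] at h1 h2
  rw [← e1, ← e2]
  refine ⟨by omega, ?_, h'.supportMin_le t i, h'.le_supportMax hM t i⟩
  rw [← ha]
  exact h'.action_iff hg t i

/-- Let `[L, H]` span the supports. If both stations route or neither does, both queues lie in one
half of the interval. If only one routes, its queue moves down from the upper half and the other up
from the lower half, so for wide intervals both outer edges move inward by one. Service and arrival
then widen the range by at most one on each side. If all queues are empty before routing, nobody
routes, the lower half is retained and its edge `0` cannot move down, so a wide interval strictly
shrinks. -/
theorem Regular.spread_succ (hM : ∀ i x, M < x → π i x = 0) (hlam : (0 : ℝ) < lam)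
    (hg : g = thresholdRule lam mu π g) (h : Regular lam mu π g M ω) (t : ℕ) :
    (spread lam mu π g (t + 1) ω ≤ max (spread lam mu π g t ω) 3) ∧
    (4 ≤ spread lam mu π g t ω → (∀ i, Xbar g ω t i = 0) →
      spread lam mu π g (t + 1) ω + 1 ≤ spread lam mu π g t ω) ∧
    (spread lam mu π g t ω ≤ 3 →
      X g ω (t + 1) 0 ≤ X g ω (t + 1) 1 + 1 ∧ X g ω (t + 1) 1 ≤ X g ω (t + 1) 0 + 1) ∧
    (X g ω (t + 1) 0 ≤ X g ω (t + 1) 1 + max (spread lam mu π g t ω) 1) ∧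
    (X g ω (t + 1) 1 ≤ X g ω (t + 1) 0 + max (spread lam mu π g t ω) 1) := by
  have hpos := h.one_le_supportMax hM hlam t
  -- Paths attaining the new extremes share the decisions of `ω` up to time `t`, hence obey the same
  -- bounds at time `t`.
  obtain ⟨ω₁, i₁, r₁, hh₁, hx₁⟩ := h.exists_eq_supportMax hM (t + 1)
  obtain ⟨ω₂, i₂, r₂, hh₂, hx₂⟩ := h.exists_eq_supportMin hM (t + 1)
  have k₁ := r₁.bounds hM hlam hg (history_succ hh₁).1 (history_succ hh₁).2 i₁
  have k₂ := r₂.bounds hM hlam hg (history_succ hh₂).1 (history_succ hh₂).2 i₂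
  have b0 := h.bounds hM hlam hg (rfl : history g t ω = _) rfl 0
  have b1 := h.bounds hM hlam hg (rfl : history g t ω = _) rfl 1
  have e₁ := Xbar_eq g ω₁ (t + 1) i₁
  have e₂ := Xbar_eq g ω₂ (t + 1) i₂
  have a₁ := Bool.toNat_le (ω₁.2 (t + 1) i₁).1
  have a₂ := Bool.toNat_le (ω₂.2 (t + 1) i₂).2
  have f0 : (∀ i, Xbar g ω t i = 0) → Xbar g ω t 0 = 0 ∧ Xbar g ω t 1 = 0 := fun h => ⟨h 0, h 1⟩
  rw [hx₁] at e₁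
  rw [hx₂] at e₂
  simp only [spread]
  generalize supportMax lam mu π g (t + 1) ω = H' at *
  generalize supportMin lam mu π g (t + 1) ω = L' at *
  generalize supportMax lam mu π g t ω = H at *
  generalize supportMin lam mu π g t ω = L at *
  simp only [sub_zero, sub_self] at b0 b1
  obtain ⟨b01, b02, b03, b04⟩ := b0
  obtain ⟨b11, b12, b13, b14⟩ := b1
  obtain ⟨k11, k12, k13, k14⟩ := k₁
  obtain ⟨k21, k22, k23, k24⟩ := k₂
  have h10 : (1 - 1 : Fin 2) = 0 := rfl
  have h01 : (1 - 0 : Fin 2) = 1 := rfl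
  have hi₁ : i₁ = 0 ∨ i₁ = 1 := by omega
  have hi₂ : i₂ = 0 ∨ i₂ = 1 := by omega
  rcases hd0 : action g ω t 0 <;> rcases hd1 : action g ω t 1 <;>
    simp only [hd0, hd1, Bool.toNat_true, Bool.toNat_false, Bool.false_eq_true, false_iff,
      true_iff] at b01 b02 b11 b12 <;>
    obtain rfl | rfl := hi₁ <;> obtain rfl | rfl := hi₂ <;>
    simp only [h10, h01, hd0, hd1, Bool.toNat_true, Bool.toNat_false,
      Bool.false_eq_true, false_iff, true_iff] at k11 k12 k21 k22 e₁ e₂ a₁ a₂ <;>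
    refine ⟨?_, fun _ hz => ?_, fun _ => ⟨?_, ?_⟩, ?_, ?_⟩ <;>
    (try have f1 := f0 hz) <;> omega

theorem Regular.spread_zero_le (hM : ∀ i x, M < x → π i x = 0) (h : Regular lam mu π g M ω) :
    spread lam mu π g 0 ω ≤ M + 1 := by
  obtain ⟨ω', i, h1, -, h3⟩ := h.exists_eq_supportMax hM 0
  have h4 := Xbar_le g h1.1 0 i
  rw [spread]
  omega

theorem Regular.spread_le (hM : ∀ i x, M < x → π i x = 0) (hlam : (0 : ℝ) < lam)
    (hg : g = thresholdRule lam mu π g) (h : Regular lam mu π g M ω) (t : ℕ) :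
    spread lam mu π g t ω ≤ M + 4 := by
  induction t with
  | zero => exact (h.spread_zero_le hM).trans (by omega)
  | succ t ih => have := (h.spread_succ hM hlam hg t).1; omega

/-- The queues differ by at most `M + 4`, so an empty station caps the total below `M + 6`; this is
the level used later. -/
theorem Regular.X_close (hM : ∀ i x, M < x → π i x = 0) (hlam : (0 : ℝ) < lam)
    (hg : g = thresholdRule lam mu π g) (h : Regular lam mu π g M ω) (t : ℕ) :
    X g ω t 0 ≤ X g ω t 1 + (M + 4) ∧ X g ω t 1 ≤ X g ω t 0 + (M + 4) := by
  cases t with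
  | zero =>
    have h0 : X g ω 0 0 ≤ M := h.1 0
    have h1 : X g ω 0 1 ≤ M := h.1 1
    omega
  | succ t =>
    have h1 := (h.spread_succ hM hlam hg t).2.2.2
    have h2 := h.spread_le hM hlam hg t
    omega

theorem Regular.spread_le_three (hM : ∀ i x, M < x → π i x = 0) (hlam : (0 : ℝ) < lam)
    (hg : g = thresholdRule lam mu π g) (h : Regular lam mu π g M ω) {τ : ℕ}
    (hτ : spread lam mu π g τ ω ≤ 3) (k : ℕ) : spread lam mu π g (τ + k) ω ≤ 3 := by
  induction k with
  | zero => exact hτ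
  | succ k ih => have := (h.spread_succ hM hlam hg (τ + k)).1; rw [← add_assoc]; omega

theorem Regular.X_balanced (hM : ∀ i x, M < x → π i x = 0) (hlam : (0 : ℝ) < lam)
    (hg : g = thresholdRule lam mu π g) (h : Regular lam mu π g M ω) {τ : ℕ}
    (hτ : spread lam mu π g τ ω ≤ 3) (k : ℕ) :
    X g ω (τ + 1 + k) 0 ≤ X g ω (τ + 1 + k) 1 + 1 ∧
      X g ω (τ + 1 + k) 1 ≤ X g ω (τ + 1 + k) 0 + 1 := by
  rw [show τ + 1 + k = τ + k + 1 by ring]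
  exact (h.spread_succ hM hlam hg (τ + k)).2.2.1 (h.spread_le_three hM hlam hg hτ k)

end Regular

/-! ### Convergence to the balanced regime -/

section Threshold

variable {lam mu : I} {π : Fin 2 → PMF ℕ} {g : Policy} {M : ℕ}

/-- The probability that the spread at time `t` is still large. -/
def wideProb (lam mu : I) (π : Fin 2 → PMF ℕ) (g : Policy) (t : ℕ) : ℝ :=
  ∫ ω, (if 4 ≤ spread lam mu π g t ω then 1 else 0) ∂law lam mu π

/-- A Lyapunov function of the spread and the total queue length. -/
def wideLyap (lam mu : I) (π : Fin 2 → PMF ℕ) (g : Policy) (M : ℕ) (a : ℝ) (t : ℕ) : ℝ :=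
  ∫ ω, (if 4 ≤ spread lam mu π g t ω then a * spread lam mu π g t ω +
    lyap (lyapBase lam mu) (M + 6) (totalX g t ω) else 0) ∂law lam mu π

theorem wideLyap_nonneg (hlam : (0 : ℝ) < lam) (hmu : (lam : ℝ) < mu) {a : ℝ} (ha : 0 ≤ a)
    (t : ℕ) : 0 ≤ wideLyap lam mu π g M a t := by
  refine integral_nonneg fun ω => ?_
  have := lyap_nonneg (one_le_lyapBase hlam hmu) (M + 6) (totalX g t ω)
  simp only [Pi.zero_apply]
  split_ifs <;> positivity

/-- While the spread is wide it never grows. If customers are present, `lyap` has the required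
drift. If the system is empty, `lyap` may rise, but `drain` keeps it empty and shrinks the spread by
one; the weight `a` makes that gain sufficient. A narrow spread stays narrow and contributes
nothing. -/
theorem wideLyap_succ_le (hM : ∀ i x, M < x → π i x = 0) (hlam : (0 : ℝ) < lam)
    (hmu : (lam : ℝ) < mu) (hg : g = thresholdRule lam mu π g) {a : ℝ} (ha : 0 ≤ a)
    (ha' : lyap (lyapBase lam mu) (M + 6) 2 + 2 * ((mu : ℝ) - lam) ≤
      a * (stepLaw lam mu).real {drain}) (t : ℕ) :
    wideLyap lam mu π g M a (t + 1) + 2 * ((mu : ℝ) - lam) * wideProb lam mu π g t ≤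
      wideLyap lam mu π g M a t := by
  classical
  have hfeas := feasible_of_eq_thresholdRule hM hlam hg
  have hγ := one_le_lyapBase hlam hmu
  set V := lyap (lyapBase lam mu) (M + 6) with hV
  -- `Ψ` bounds the next integrand by a function of the present state and the fresh step, in the
  -- form needed for `integral_step`.
  set Ψ : ℕ × (Fin 2 → ℕ) → Step → ℝ := fun y w => if 4 ≤ y.1 then
    a * y.1 + V (total y.2 w) - (if y.2 = 0 then Set.indicator {drain} (fun _ => a) w else 0)
    else 0 with hΨ
  have hk : AdaptedAt t fun ω => (spread lam mu π g t ω, X g ω t) :=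
    (spread_adaptedAt lam mu π g t).comp₂ (X_adaptedAt g t) Prod.mk
  have hV0 : ∀ s, 0 ≤ V s := lyap_nonneg hγ _
  have hΨad : AdaptedAt (t + 1) fun ω => Ψ (spread lam mu π g t ω, X g ω t) (ω.2 t) :=
    fun ω ω' h1 h2 => by
      have := hk ω ω' h1 fun s hs => h2 s (by omega)
      simp only at this
      simp only [this, h2 t (by omega)]
  have h1 : wideLyap lam mu π g M a (t + 1) ≤
      ∫ ω, Ψ (spread lam mu π g t ω, X g ω t) (ω.2 t) ∂law lam mu π := by
    refine integral_mono_ae (AdaptedAt.integrable (t := t + 1) hM ?_) (hΨad.integrable hM) ?_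
    · exact (spread_adaptedAt lam mu π g (t + 1)).comp₂ (totalX_adaptedAt g (t + 1))
        fun n s => if 4 ≤ n then a * n + V s else 0
    filter_upwards [ae_regular (lam := lam) (mu := mu) hM g] with ω hω
    obtain ⟨hs1, hs2, -⟩ := hω.spread_succ hM hlam hg t
    simp only [hΨ]
    rw [totalX_succ hfeas]
    by_cases h4 : 4 ≤ spread lam mu π g t ω
    · rw [if_pos h4]
      by_cases hd : X g ω t = 0 ∧ ω.2 t = drain
      · have hs3 := hs2 h4 fun i => by rw [Xbar_eq, hd.1, hd.2]; simp [drain]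
        rw [if_pos hd.1, hd.2, Set.indicator_of_mem (Set.mem_singleton _)]
        have h5 : ((spread lam mu π g (t + 1) ω : ℕ) : ℝ) + 1 ≤ (spread lam mu π g t ω : ℕ) := by
          exact_mod_cast hs3
        have h6 := hV0 (total (X g ω t) drain)
        have h7 := mul_le_mul_of_nonneg_left h5 ha
        have h8 : 0 ≤ a * (spread lam mu π g (t + 1) ω : ℕ) := by positivity
        split_ifs <;> linarith
      · have h0 : (if X g ω t = 0 then Set.indicator {drain} (fun _ => a) (ω.2 t) else 0) = 0 := by
          split_ifs with hx
          · exact Set.indicator_of_notMem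
              (show ω.2 t ∉ ({drain} : Set Step) from fun hw => hd ⟨hx, hw⟩) _
          · rfl
        rw [h0]
        have h5 : ((spread lam mu π g (t + 1) ω : ℕ) : ℝ) ≤ (spread lam mu π g t ω : ℕ) := by
          exact_mod_cast (by omega)
        have h6 := hV0 (total (X g ω t) (ω.2 t))
        have h7 := mul_le_mul_of_nonneg_left h5 ha
        have h8 : 0 ≤ a * (spread lam mu π g (t + 1) ω : ℕ) := by positivity
        split_ifs <;> linarith
    · rw [if_neg h4, if_neg (by omega)]
  rw [integral_step hM hk Ψ] at h1
  rw [wideProb, ← integral_const_mul]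
  refine (add_le_add_left h1 _).trans ?_
  have hI := integrable_stepLaw lam mu
  have hi1 : Integrable (fun ω => ∫ w, Ψ (spread lam mu π g t ω, X g ω t) w ∂stepLaw lam mu)
      (law lam mu π) := (hk.comp fun y => ∫ w, Ψ y w ∂stepLaw lam mu).integrable hM
  have hi2 : Integrable (fun ω => 2 * ((mu : ℝ) - lam) *
      (if 4 ≤ spread lam mu π g t ω then 1 else 0)) (law lam mu π) :=
    ((spread_adaptedAt lam mu π g t).comp fun n => 2 * ((mu : ℝ) - lam) *
      (if 4 ≤ n then 1 else 0)).integrable hM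
  have hi3 : Integrable (fun ω => if 4 ≤ spread lam mu π g t ω then
      a * spread lam mu π g t ω + V (totalX g t ω) else 0) (law lam mu π) :=
    ((spread_adaptedAt lam mu π g t).comp₂ (totalX_adaptedAt g t)
        fun n s => if 4 ≤ n then a * n + V s else 0).integrable hM
  rw [← integral_add hi1 hi2]
  refine integral_mono_ae (hi1.add hi2) hi3 ?_
  filter_upwards [ae_regular (lam := lam) (mu := mu) hM g] with ω hω
  simp only [hΨ]
  by_cases h4 : 4 ≤ spread lam mu π g t ω
  · simp only [h4, if_true, mul_one]
    rw [integral_sub (hI _) (hI _), integral_add (hI _) (hI _)]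
    simp only [integral_const, probReal_univ, one_smul]
    by_cases hx : X g ω t = 0
    · simp only [hx, if_true, totalX]
      rw [integral_indicator_const _ (measurableSet_singleton drain), smul_eq_mul]
      have h5 : ∫ w, V (total 0 w) ∂stepLaw lam mu ≤ V 2 := by
        have := integral_mono (hI (fun w => V (total 0 w))) (hI fun _ => V 2) fun w =>
          lyap_mono hγ _ (by
            have h2 := Bool.toNat_le (w 0).1
            have h3 := Bool.toNat_le (w 1).1
            simp only [total, Pi.zero_apply]; omega)
        simpa using this
      have h6 := hV0 (0 + 0)
      simp only [Pi.zero_apply]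
      linarith
    · simp only [hx, if_false, integral_zero]
      obtain ⟨c1, c2⟩ := hω.X_close hM hlam hg t
      have h5 := stepMean_lyap_le hlam hmu (R := M + 6) (x := X g ω t)
        (by
          by_contra h0
          refine hx (funext fun i => ?_)
          fin_cases i
          · change X g ω t 0 = 0; omega
          · change X g ω t 1 = 0; omega) (by omega)
      rw [← hV, stepMean] at h5
      rw [totalX]
      linarith
  · simp [h4]

/-- Telescoping the drift bounds the expected number of times with wide spread. -/
theorem tendsto_wideProb (hM : ∀ i x, M < x → π i x = 0) (hlam : (0 : ℝ) < lam)
    (hmu : (lam : ℝ) < mu) (hg : g = thresholdRule lam mu π g) :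
    Tendsto (wideProb lam mu π g) atTop (𝓝 0) := by
  have hγ := one_le_lyapBase hlam hmu
  have hq := drain_pos_of_lt hlam hmu
  have he : 0 < 2 * ((mu : ℝ) - lam) := by linarith
  set a := (lyap (lyapBase lam mu) (M + 6) 2 + 2 * ((mu : ℝ) - lam)) /
    (stepLaw lam mu).real {drain} with hadef
  have ha : 0 ≤ a := div_nonneg (add_nonneg (lyap_nonneg hγ _ _) he.le) hq.le
  have ha' : lyap (lyapBase lam mu) (M + 6) 2 + 2 * ((mu : ℝ) - lam) ≤
      a * (stepLaw lam mu).real {drain} := by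
    rw [hadef, div_mul_cancel₀ _ hq.ne']
  have hsum : ∀ T, wideLyap lam mu π g M a T +
      2 * ((mu : ℝ) - lam) * ∑ t ∈ Finset.range T, wideProb lam mu π g t ≤
        wideLyap lam mu π g M a 0 := by
    intro T
    induction T with
    | zero => simp
    | succ T ih =>
      have := wideLyap_succ_le hM hlam hmu hg ha ha' T
      rw [Finset.sum_range_succ, mul_add]
      linarith
  refine (summable_of_sum_range_le (c := wideLyap lam mu π g M a 0 / (2 * ((mu : ℝ) - lam)))
    (fun t => integral_nonneg fun ω => ?_) fun T => ?_).tendsto_atTop_zero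
  · simp only [Pi.zero_apply]
    split_ifs <;> norm_num
  · rw [le_div_iff₀ he, mul_comm]
    have h1 := hsum T
    have h2 := wideLyap_nonneg (π := π) (g := g) (M := M) hlam hmu ha T
    simp only [wideProb] at h1
    linarith

/-! ### The cost of the threshold policy -/

/-- The excess of the total over `M + 6` starts below `2 * M`, and both stations are busy while the
total is at least `M + 6`, so the balanced chain dominates it. -/
theorem integral_sub_le_iterate (hM : ∀ i x, M < x → π i x = 0) (hlam : (0 : ℝ) < lam)
    (hg : g = thresholdRule lam mu π g) {f : ℕ → ℝ} (hf : Monotone f) (t : ℕ) :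
    ∫ ω, f (totalX g t ω - (M + 6)) ∂law lam mu π ≤ (balancedOp lam mu)^[t] f (2 * M) := by
  induction t generalizing f with
  | zero =>
    have h := integral_mono_ae (μ := law lam mu π)
      (((totalX_adaptedAt g 0).comp fun s => f (s - (M + 6))).integrable hM)
      (integrable_const (f (2 * M))) ?_
    · simpa using h
    filter_upwards [ae_initial_le lam mu hM] with ω hω
    refine hf ?_
    have h0 : X g ω 0 0 ≤ M := hω 0
    have h1 : X g ω 0 1 ≤ M := hω 1
    rw [totalX]
    omega
  | succ t ih =>
    rw [integral_totalX_succ hM (feasible_of_eq_thresholdRule hM hlam hg) t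
      fun s => f (s - (M + 6)), Function.iterate_succ_apply]
    refine (integral_mono_ae
      (((X_adaptedAt g t).comp fun x => stepMean lam mu (fun s => f (s - (M + 6))) x).integrable hM)
      (((totalX_adaptedAt g t).comp fun s => balancedOp lam mu f (s - (M + 6))).integrable hM)
      ?_).trans (ih (balancedOp_monotone hf))
    filter_upwards [ae_regular (lam := lam) (mu := mu) hM g] with ω hω
    obtain ⟨c1, c2⟩ := hω.X_close hM hlam hg t
    exact stepMean_sub_le hf (by omega)

/-- Narrowness is decided by the past at time `τ`, and on that event the queues are balanced from `τ
+ 1` on, so each later step applies `balancedOp` exactly. -/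
theorem integral_narrow_eq (hM : ∀ i x, M < x → π i x = 0) (hlam : (0 : ℝ) < lam)
    (hg : g = thresholdRule lam mu π g) (f : ℕ → ℝ) (F : ℝ) (τ k : ℕ) :
    ∫ ω, (if 4 ≤ spread lam mu π g τ ω then F else f (totalX g (τ + 1 + k) ω)) ∂law lam mu π =
      ∫ ω, (if 4 ≤ spread lam mu π g τ ω then F else
        (balancedOp lam mu)^[k] f (totalX g (τ + 1) ω)) ∂law lam mu π := by
  induction k generalizing f with
  | zero => rfl
  | succ k ih =>
    rw [Function.iterate_succ_apply, ← ih (balancedOp lam mu f), ← add_assoc]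
    simp only [totalX_succ (feasible_of_eq_thresholdRule hM hlam hg)]
    have h := integral_step (lam := lam) (mu := mu) hM (t := τ + 1 + k)
      (((spread_adaptedAt lam mu π g τ).mono (by omega)).comp₂ (X_adaptedAt g (τ + 1 + k)) Prod.mk)
      fun y w => if 4 ≤ y.1 then F else f (total y.2 w)
    rw [h]
    refine integral_congr_ae ?_
    filter_upwards [ae_regular (lam := lam) (mu := mu) hM g] with ω hω
    by_cases h4 : 4 ≤ spread lam mu π g τ ω
    · simp [h4]
    · simp only [h4, if_false]
      obtain ⟨c1, c2⟩ := hω.X_balanced hM hlam hg (show spread lam mu π g τ ω ≤ 3 by omega) k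
      exact stepMean_eq_balancedOp f c1 c2

theorem integral_narrow_le (hM : ∀ i x, M < x → π i x = 0) (hlam : (0 : ℝ) < lam)
    (hg : g = thresholdRule lam mu π g) {f : ℕ → ℝ} (hf : Monotone f) (F : ℝ) (τ k : ℕ) {B : ℝ}
    (hB : (balancedOp lam mu)^[k] f (2 * M + 4 * (τ + 1)) ≤ B) :
    ∫ ω, (if 4 ≤ spread lam mu π g τ ω then F else f (totalX g (τ + 1 + k) ω)) ∂law lam mu π ≤
      B + (F - B) * wideProb lam mu π g τ := by
  rw [integral_narrow_eq hM hlam hg]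
  have hi : Integrable (fun ω => if 4 ≤ spread lam mu π g τ ω then (1 : ℝ) else 0)
      (law lam mu π) :=
    ((spread_adaptedAt lam mu π g τ).comp fun n => if 4 ≤ n then (1 : ℝ) else 0).integrable hM
  have h : ∫ ω, (B + (F - B) * (if 4 ≤ spread lam mu π g τ ω then 1 else 0)) ∂law lam mu π =
      B + (F - B) * wideProb lam mu π g τ := by
    rw [integral_add (integrable_const _) (hi.const_mul _), integral_const_mul]
    simp [wideProb]
  rw [← h]
  refine integral_mono_ae (AdaptedAt.integrable (t := τ + 1) hM ?_)
    ((integrable_const _).add (hi.const_mul _)) ?_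
  · exact ((spread_adaptedAt lam mu π g τ).mono (by omega)).comp₂ (totalX_adaptedAt g (τ + 1))
      fun n s => if 4 ≤ n then F else (balancedOp lam mu)^[k] f s
  filter_upwards [ae_initial_le lam mu hM] with ω hω
  split_ifs with h4
  · linarith
  · have h0 := X_le g hω (τ + 1) 0
    have h1 := X_le g hω (τ + 1) 1
    have h2 : totalX g (τ + 1) ω ≤ 2 * M + 4 * (τ + 1) := by rw [totalX]; omega
    have := (iterate_monotone (lam := lam) (mu := mu) hf k h2).trans hB
    linarith

/-- The cost is split at level `N`: the bounded part sees the exact balanced cost once the spread is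
narrow and is at most `balancedCost c N` otherwise; the tail is bounded without regard to the
spread. -/
theorem stageCost_le (hM : ∀ i x, M < x → π i x = 0) (hlam : (0 : ℝ) < lam)
    (hg : g = thresholdRule lam mu π g) {c : ℕ → ℝ} (hc : Monotone c) (N τ k : ℕ) :
    stageCost lam mu c π g (τ + 1 + k) ≤
      ∫ ω, (if 4 ≤ spread lam mu π g τ ω then balancedCost c N else
        balancedCost c (min (totalX g (τ + 1 + k) ω) N)) ∂law lam mu π +
      (balancedOp lam mu)^[τ + 1 + k]
        (fun s => tail (balancedCost c) N (s + (2 * M + 11))) (2 * M) := by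
  have hf := balancedCost_mono hc
  set t := τ + 1 + k with ht
  have hr := tail_mono hf N
  refine le_trans ?_ (add_le_add_right (integral_sub_le_iterate hM hlam hg
    (f := fun s => tail (balancedCost c) N (s + (2 * M + 11))) (fun a b h => hr (by omega)) t) _)
  have hi1 : Integrable (fun ω => if 4 ≤ spread lam mu π g τ ω then balancedCost c N else
        balancedCost c (min (totalX g t ω) N)) (law lam mu π) :=
    AdaptedAt.integrable (t := t) hM
      (((spread_adaptedAt lam mu π g τ).mono (by omega)).comp₂ (totalX_adaptedAt g t)
        fun n s => if 4 ≤ n then balancedCost c N else balancedCost c (min s N))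
  have hi2 := ((totalX_adaptedAt g t).comp fun s =>
    tail (balancedCost c) N (s - (M + 6) + (2 * M + 11))).integrable (lam := lam) (mu := mu) hM
  rw [← integral_add hi1 hi2]
  refine integral_mono_ae ((cost_adaptedAt c g t).integrable hM) (hi1.add hi2) ?_
  filter_upwards [ae_regular (lam := lam) (mu := mu) hM g] with ω hω
  -- The imbalance `M + 4` costs a shift by `M + 5`, and the subtracted level `M + 6` must be
  -- restored: together `2 * M + 11`.
  have hle : tail (balancedCost c) N (totalX g t ω + (M + 5)) ≤
      tail (balancedCost c) N (totalX g t ω - (M + 6) + (2 * M + 11)) := hr (by omega)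
  split_ifs with h4
  · obtain ⟨c1, c2⟩ := hω.X_close hM hlam hg t
    have h1 := add_le_balancedCost hc c1 c2
    have h2 := min_add_tail (f := balancedCost c) N (totalX g t ω + (M + 5))
    have h3 : balancedCost c (min (totalX g t ω + (M + 5)) N) ≤ balancedCost c N :=
      hf (min_le_right _ _)
    change _ ≤ balancedCost c (totalX g t ω + (M + 5)) at h1
    linarith
  · obtain ⟨c1, c2⟩ := hω.X_balanced hM hlam hg (show spread lam mu π g τ ω ≤ 3 by omega) k
    have h1 := add_eq_balancedCost c c1 c2
    have h2 := min_add_tail (f := balancedCost c) N (totalX g t ω)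
    have h3 : tail (balancedCost c) N (totalX g t ω) ≤
      tail (balancedCost c) N (totalX g t ω + (M + 5)) := hr (by omega)
    change _ = balancedCost c (totalX g t ω) at h1
    linarith

/-- The stage costs of the threshold policy are asymptotically at most the limit of the mean costs
of the balanced system. -/
theorem eventually_stageCost_le (hM : ∀ i x, M < x → π i x = 0) (hlam : (0 : ℝ) < lam)
    (hmu : (lam : ℝ) < mu) (hg : g = thresholdRule lam mu π g) {c : ℕ → ℝ} (hc : Monotone c)
    {L : ℝ} (hL : Tendsto (fun t => (balancedOp lam mu)^[t] (balancedCost c) 0) atTop (𝓝 L))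
    {δ : ℝ} (hδ : 0 < δ) : ∀ᶠ t in atTop, stageCost lam mu c π g t ≤ L + δ := by
  have hf := balancedCost_mono hc
  obtain ⟨N, hN⟩ := tail_uniformly_small hlam hf hL (2 * M) (2 * M + 11)
    (show 0 < δ / 2 by linarith)
  set F := balancedCost c N
  set f : ℕ → ℝ := fun s => balancedCost c (min s N) with hfdef
  have hfm : Monotone f := fun a b h => hf (min_le_min_right _ h)
  have hfF : ∀ s, f s ≤ f 0 + (F - f 0) := fun s => by
    rw [add_sub_cancel]; exact hf (min_le_right _ _)
  have hfL : ∀ k, (balancedOp lam mu)^[k] f 0 ≤ L := fun k =>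
    (iterate_le (fun s => hf (min_le_left _ _)) k 0).trans
      ((iterate_zero_monotone hf).ge_of_tendsto hL k)
  -- Order of choices: `N` makes the tail small and fixes the bound `F`; then `τ` makes the wide
  -- event negligible; finally `k` grows until the state at `τ + 1`, at most `K` on almost every
  -- path, is forgotten.
  obtain ⟨τ, hτ⟩ : ∃ τ, (F - L) * wideProb lam mu π g τ < δ / 2 := by
    have h := (tendsto_wideProb hM hlam hmu hg).const_mul (F - L)
    rw [mul_zero] at h
    exact (h.eventually (gt_mem_nhds (by linarith))).exists
  set K := 2 * M + 4 * (τ + 1)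
  have hB : ∀ᶠ k in atTop, (L + (F - f 0) * survival lam mu k K) +
      (F - (L + (F - f 0) * survival lam mu k K)) * wideProb lam mu π g τ < L + δ / 2 := by
    have h1 : Tendsto (fun k => L + (F - f 0) * survival lam mu k K) atTop (𝓝 L) := by
      simpa using (tendsto_survival hlam hmu K).const_mul (F - f 0) |>.const_add L
    have h2 := h1.add ((h1.const_sub F).mul_const (wideProb lam mu π g τ))
    exact h2.eventually (gt_mem_nhds (by linarith))
  have hshift : ∀ᶠ k in atTop, stageCost lam mu c π g (k + (τ + 1)) ≤ L + δ := by
    filter_upwards [hB, (tendsto_add_atTop_nat (τ + 1)).eventually hN] with k hk1 hk2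
    have h1 := stageCost_le hM hlam hg hc N τ k
    have h2 := integral_narrow_le hM hlam hg hfm F τ k (B := L + (F - f 0) * survival lam mu k K)
      ((iterate_le_survival hfm hfF k K).trans (add_le_add_left (hfL k) _))
    rw [add_comm k] at hk2 ⊢
    simp only [hfdef] at h1 h2
    linarith
  rw [eventually_atTop] at hshift ⊢
  obtain ⟨k₀, hk₀⟩ := hshift
  refine ⟨k₀ + (τ + 1), fun t ht => ?_⟩
  have := hk₀ (t - (τ + 1)) (by omega)
  rwa [show t - (τ + 1) + (τ + 1) = t by omega] at this

/-! ### Average costs -/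

theorem averageCost_eq (hM : ∀ i x, M < x → π i x = 0) (c : ℕ → ℝ) (g : Policy) :
    averageCost lam mu c π g = limsup (fun T : ℕ =>
      (((T : ℝ)⁻¹ * ∑ t ∈ Finset.range T, stageCost lam mu c π g t : ℝ) : EReal)) atTop := by
  simp only [averageCost, horizonCost_eq_sum hM, div_eq_inv_mul]

theorem averageCost_le (hM : ∀ i x, M < x → π i x = 0) (hlam : (0 : ℝ) < lam)
    (hmu : (lam : ℝ) < mu) (hg : g = thresholdRule lam mu π g) {c : ℕ → ℝ} (hc : Monotone c)
    {L : ℝ} (hL : Tendsto (fun t => (balancedOp lam mu)^[t] (balancedCost c) 0) atTop (𝓝 L)) :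
    averageCost lam mu c π g ≤ L := by
  rw [averageCost_eq hM]
  -- Only an upper bound on the stage costs is at hand; taking the maximum with `L` gives a
  -- convergent sequence to average.
  have h1 : Tendsto (fun t => max (stageCost lam mu c π g t) L) atTop (𝓝 L) := by
    refine tendsto_order.2 ⟨fun b hb => Eventually.of_forall fun t => lt_max_of_lt_right hb,
      fun b hb => ?_⟩
    filter_upwards [eventually_stageCost_le hM hlam hmu hg hc hL
      (show 0 < (b - L) / 2 by linarith)] with t ht
    exact max_lt (by linarith) hb
  have h2 : Tendsto (fun T : ℕ => (((T : ℝ)⁻¹ *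
      ∑ t ∈ Finset.range T, max (stageCost lam mu c π g t) L : ℝ) : EReal)) atTop (𝓝 (L : EReal)) :=
    (continuous_coe_real_ereal.tendsto L).comp h1.cesaro
  rw [← h2.limsup_eq]
  refine limsup_le_limsup (Eventually.of_forall fun T => ?_)
  rw [EReal.coe_le_coe_iff]
  exact mul_le_mul_of_nonneg_left (Finset.sum_le_sum fun t _ => le_max_left _ _) (by positivity)

theorem le_averageCost (hM : ∀ i x, M < x → π i x = 0) (hg : Feasible g) {c : ℕ → ℝ}
    (hc : Monotone c) (hc' : ∀ n, c (n + 1) - c n ≤ c (n + 2) - c (n + 1)) {L : ℝ}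
    (hL : Tendsto (fun t => (balancedOp lam mu)^[t] (balancedCost c) 0) atTop (𝓝 L)) :
    L ≤ averageCost lam mu c π g := by
  rw [averageCost_eq hM]
  have h2 := (continuous_coe_real_ereal.tendsto L).comp hL.cesaro
  rw [← h2.limsup_eq]
  refine limsup_le_limsup (Eventually.of_forall fun T => ?_)
  simp only [Function.comp_apply]
  rw [EReal.coe_le_coe_iff]
  exact mul_le_mul_of_nonneg_left
    (Finset.sum_le_sum fun t _ => iterate_le_stageCost hM hg hc hc' t) (by positivity)

/-- Capping the sequence at `a n` makes it eventually constant, so its averages tend to `a n`, which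
is arbitrarily large. -/
theorem tendsto_average_atTop {a : ℕ → ℝ} (ha : Monotone a) (h : Tendsto a atTop atTop) :
    Tendsto (fun T : ℕ => (T : ℝ)⁻¹ * ∑ t ∈ Finset.range T, a t) atTop atTop := by
  refine tendsto_atTop.2 fun b => ?_
  obtain ⟨n, hn⟩ := (h.eventually (eventually_ge_atTop (b + 1))).exists
  have h1 : Tendsto (fun t => min (a t) (a n)) atTop (𝓝 (a n)) :=
    tendsto_const_nhds.congr' ((eventually_ge_atTop n).mono fun t ht => (min_eq_right (ha ht)).symm)
  filter_upwards [h1.cesaro.eventually (lt_mem_nhds (show b < a n by linarith))] with T hT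
  exact hT.le.trans (mul_le_mul_of_nonneg_left
    (Finset.sum_le_sum fun t _ => min_le_left _ _) (by positivity))

theorem averageCost_eq_top (hM : ∀ i x, M < x → π i x = 0) (hg : Feasible g) {c : ℕ → ℝ}
    (hc : Monotone c) (hc' : ∀ n, c (n + 1) - c n ≤ c (n + 2) - c (n + 1))
    (h : Tendsto (fun t => (balancedOp lam mu)^[t] (balancedCost c) 0) atTop atTop) :
    averageCost lam mu c π g = ⊤ := by
  rw [averageCost_eq hM]
  refine Tendsto.limsup_eq (EReal.tendsto_coe_nhds_top_iff.2 ?_)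
  refine tendsto_atTop_mono (fun T => ?_)
    (tendsto_average_atTop (iterate_zero_monotone (balancedCost_mono hc)) h)
  exact mul_le_mul_of_nonneg_left
    (Finset.sum_le_sum fun t _ => iterate_le_stageCost hM hg hc hc' t) (by positivity)

end Threshold

end Routing

end

theorem theorem2 (lam mu : unitInterval) (hlam : 0 < lam) (hmu : lam < mu)
    (c : ℕ → ℝ) (hc_mono : Monotone c)
    (hc_conv : ∀ n, c (n + 1) - c n ≤ c (n + 2) - c (n + 1))
    (π : Fin 2 → PMF ℕ) (hπ : ∃ M : ℕ, ∀ i x, M < x → π i x = 0)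
    (hcost : ∃ J : ℝ, Filter.Tendsto
      (fun T : ℕ => Routing.horizonCost lam mu c π Routing.noRouting T / T)
      Filter.atTop (nhds J)) :
    Routing.Feasible (Routing.gHat lam mu π) ∧
      ∀ g : Routing.Policy, Routing.Feasible g →
        Routing.averageCost lam mu c π (Routing.gHat lam mu π) ≤
          Routing.averageCost lam mu c π g := by
  obtain ⟨M, hM⟩ := hπ
  have hlam' : (0 : ℝ) < lam := hlam
  have hmu' : (lam : ℝ) < mu := hmu
  have hg := Routing.gHat_eq lam mu π
  refine ⟨Routing.feasible_of_eq_thresholdRule hM hlam' hg, fun g hgf => ?_⟩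
  -- The monotone mean costs of the balanced chain either diverge, and every policy costs `⊤`, or
  -- converge to an `L` separating the two average costs.
  rcases tendsto_atTop_of_monotone (Routing.iterate_zero_monotone (lam := lam) (mu := mu)
    (Routing.balancedCost_mono hc_mono)) with h | ⟨L, hL⟩
  · rw [Routing.averageCost_eq_top hM hgf hc_mono hc_conv h]
    exact le_top
  · exact (Routing.averageCost_le hM hlam' hmu' hg hc_mono hL).trans
      (Routing.le_averageCost hM hgf hc_mono hc_conv hL)
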